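/- **Model.** Let $G^*=\{G^*_1,\dots,G^*_K\}$ be a partition of $\{1,\dots,p\}$ into $K$ groups and let $m=\min_k|G^*_k|$. Let $X\in\mathbb R^p$ be a centered Gaussian vector with the latent decomposition $$X_a=Z_k+E_a\qquad\text{for all }a\in G^*_k,\ k=1,\dots,K,$$ where $Z\in\mathbb R^K$ and $E\in\mathbb R^p$ are square-integrable, centered and independent of each other, and where the entries of $E$ are independent, with variances that are equal within each group. Write $C^*=\mathrm{Cov}(Z)$, $\Gamma=\mathrm{Cov}(E)$ and $$\Delta(C^*)=\min_{j<k}\,(C^*_{jj}+C^*_{kk}-2C^*_{jk})$$ (with $\min\emptyset=+\infty$), and assume $m>1$ and $\Delta(C^*)>0$. Let $X^{(1)},\dots,X^{(n)}$ be i.i.d. copies of $X$ and $\widehat\Sigma=\frac1n\sum_{i=1}^nX^{(i)}(X^{(i)})^t$. For a matrix $M$ let $|M|_\infty=\max_{a,b}|M_{ab}|$, for a diagonal matrix $D$ let $|D|_V=\max_aD_{aa}-\min_aD_{aa}$, and let $\langle M,B\rangle=\sum_{a,b}M_{ab}B_{ab}$. Let $B^*\in\mathbb R^{p\times p}$ be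 the matrix with $B^*_{ab}=1/|G^*_k|$ if $a,b$ are both in $G^*_k$ and $B^*_{ab}=0$ if $a,b$ are in different groups, and let $$\mathcal C=\Big\{B\in\mathbb R^{p\times p}:\ B\text{ symmetric positive semidefinite},\ \sum_aB_{ab}=1\ \forall b,\ B_{ab}\ge0\ \forall a,b,\ \mathrm{tr}(B)=K\Big\}.$$ **Theorem.** There exist positive numerical constants $c_1,c_2,c_3$ such that the following holds for all $n,p,K$ and all models as above. Let $\widehat\Gamma$ be any estimator of $\Gamma$ (a random diagonal matrix) and $\delta_{n,p}$ a real number such that $|\widehat\Gamma-\Gamma|_V\le\delta_{n,p}$ with probability at least $1-c_3/(2p)$. Assume that $\log p\le c_1n$ and that $$\Delta(C^*)\ \ge\ c_2\left[|\Gamma|_\infty\left\{\sqrt{\frac{\log p}{mn}}+\sqrt{\frac{p}{nm^2}}+\frac{\log p}{n}+\frac{p}{nm}\right\}+\frac{\delta_{n,p}}{m}\right].$$ Then, with probability higher than $1-c_3/p$, the semidefinite program $$\widehat B=\operatorname*{argmax}_{B\in\mathcal C}\ \langle\widehat\Sigma-\widehat\Gamma,B\rangle$$ has a unique solution and $\widehat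 B=B^*$. -/

import Mathlib

open MeasureTheory ProbabilityTheory
open scoped Matrix

noncomputable section

namespace Pecok

/-! ### Partitions, given by a label map `g`: the group `G_k` is `{a | g a = k}` -/

/-- The group `G_k`. -/
def group {p K : ℕ} (g : Fin p → Fin K) (k : Fin K) : Finset (Fin p) :=
  Finset.univ.filter fun a => g a = k

/-- The size `m` of the smallest group, `m = min_k |G_k|` (`0` when there is no group). -/
def minGroupSize {p K : ℕ} (g : Fin p → Fin K) : ℕ :=
  ⨅ k, (group g k).card

/-- The normalized partnership matrix of the partition: `1 / |G_k|` if `a` and `b` are both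
in `G_k`, and `0` if they are in different groups. -/
def partnershipMatrix {p K : ℕ} (g : Fin p → Fin K) : Matrix (Fin p) (Fin p) ℝ :=
  Matrix.of fun a b => if g a = g b then 1 / ((group g (g a)).card : ℝ) else 0

/-! ### Norms and the separation of the clusters -/

/-- The entrywise `ℓ^∞` norm `|M|_∞`. -/
def entrySupNorm {p : ℕ} (M : Matrix (Fin p) (Fin p) ℝ) : ℝ :=
  ⨆ a, ⨆ b, |M a b|

/-- The variation semi-norm `|D|_V = max_a D_aa - min_a D_aa` of a diagonal matrix. -/
def variationSeminorm {p : ℕ} (D : Matrix (Fin p) (Fin p) ℝ) : ℝ :=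
  (⨆ a, D a a) - ⨅ a, D a a

/-- The separation `Δ(C) = min_{j < k} (C_jj + C_kk - 2 C_jk)`. It is valued in the extended reals
so that the minimum over the empty set, when there is only one cluster, is `+∞`. -/
def separation {K : ℕ} (C : Matrix (Fin K) (Fin K) ℝ) : EReal :=
  ⨅ (j : Fin K) (k : Fin K) (_ : j < k), ((C j j + C k k - 2 * C j k : ℝ) : EReal)

/-! ### The latent model -/

/-- The covariance matrix of a random vector. -/
def covMatrix {ι Ω : Type*} [MeasurableSpace Ω] (P : Measure Ω) (Y : Ω → ι → ℝ) :
    Matrix ι ι ℝ :=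
  Matrix.of fun i j => cov[fun ω => Y ω i, fun ω => Y ω j; P]

/-- `X` has the latent decomposition `X_a = Z_k + E_a` for `a ∈ G_k`, with respect to the partition
given by `g`: the latent vector `Z` and the error vector `E` are square integrable, centered and
independent, the entries of `E` are independent, and the error variances are equal within
each group. -/
structure LatentDecomposition {p K : ℕ} {Ω : Type*} [MeasurableSpace Ω] (P : Measure Ω)
    (g : Fin p → Fin K) (X : Ω → Fin p → ℝ) (Z : Ω → Fin K → ℝ) (E : Ω → Fin p → ℝ) : Prop where
  measurable_Z : Measurable Z
  measurable_E : Measurable E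
  memLp_Z : ∀ k, MemLp (fun ω => Z ω k) 2 P
  memLp_E : ∀ a, MemLp (fun ω => E ω a) 2 P
  mean_Z : ∀ k, ∫ ω, Z ω k ∂P = 0
  mean_E : ∀ a, ∫ ω, E ω a ∂P = 0
  indep_Z_E : IndepFun Z E P
  indep_E : iIndepFun (fun a ω => E ω a) P
  var_E : ∀ a b, g a = g b → Var[fun ω => E ω a; P] = Var[fun ω => E ω b; P]
  decomp : ∀ ω a, X ω a = Z ω (g a) + E ω a

/-! ### The estimator -/

/-- The sample covariance matrix `(1/n) ∑ᵢ xᵢ xᵢᵗ` of the observations `x₁, …, xₙ`. -/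
def sampleCov {n p : ℕ} (x : Fin n → Fin p → ℝ) : Matrix (Fin p) (Fin p) ℝ :=
  Matrix.of fun a b => (1 / (n : ℝ)) * ∑ i, x i a * x i b

/-- The Frobenius scalar product. -/
def frobInner {p : ℕ} (M B : Matrix (Fin p) (Fin p) ℝ) : ℝ :=
  ∑ a, ∑ b, M a b * B a b

/-- The domain `𝒞` of the semi-definite program, with `K` clusters. -/
def sdpDomain (p K : ℕ) : Set (Matrix (Fin p) (Fin p) ℝ) :=
  {B | B.PosSemidef ∧ (∀ b, ∑ a, B a b = 1) ∧ (∀ a b, 0 ≤ B a b) ∧ B.trace = K}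

/-- The set of all solutions of the program: the maximizers of `B ↦ ⟨M, B⟩` over `𝒞`. -/
def sdpArgmax {p : ℕ} (K : ℕ) (M : Matrix (Fin p) (Fin p) ℝ) :
    Set (Matrix (Fin p) (Fin p) ℝ) :=
  {B | B ∈ sdpDomain p K ∧ ∀ B' ∈ sdpDomain p K, frobInner M B' ≤ frobInner M B}

end Pecok

end

/-! Write e_a = avg_a + dev_a with avg_a = B* e_a. For symmetric M and symmetric B with unit row
sums, `frobInner_expand` and `frobInner_partnership` give ⟨M,B*⟩ − ⟨M,B⟩ = Σ B_ab cost_ab − Σ B_ab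
M(dev_a, dev_b), where cost_ab = M(avg_a − avg_b, avg_a − avg_b)/2 − 2 M(avg_a − avg_b, dev_b)
vanishes inside groups. For M = I the trace constraint turns this into Σ B_ab ⟨dev_a, dev_b⟩ = Σ
B_ab |avg_a − avg_b|²/2, which is at most 1/m times the mass that B puts across groups. Since B is a
Gram matrix, a bound κ for the quadratic form of M on group-centered vectors bounds the last sum by
κ/m times the same mass. So B* wins strictly once cost_ab > κ/m across groups
(`sdpArgmax_eq_of_separated`); no dual certificate is needed.

The trace is constant on the domain, so a multiple of I may be added to the matrix of the program,
which then reads N + C*_{g(a)g(b)} + D: N is the sample covariance minus its mean, and D is diagonal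
with entries in [0, δ]. The lifted C* kills centered vectors and equals Δ_ab = C*_jj + C*_kk −
2C*_jk (j, k the groups of a, b) on avg_a − avg_b; D costs O(δ/m) (`sdpArgmax_eq_of_small_noise`).

The noise N is controlled by a chi-square Chernoff bound and polarization (`measure_abs_bilin`).
With γ = |Γ|_∞, the variance is at most Δ_ab + 2γ/m along avg_a − avg_b and γ along centered unit
vectors. A union bound over pairs and over a net of the ball (`exists_measure_bad_le`) yields terms
that `separation_arith` absorbs into Δ. -/

namespace Pecok

/-! ### Group averages and deviations from them -/

section Deterministic

variable {p K : ℕ} {g : Fin p → Fin K}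

/-- The bilinear form `(u, v) ↦ uᵗ M v`. -/
noncomputable abbrev bilin (M : Matrix (Fin p) (Fin p) ℝ) : (Fin p → ℝ) →ₗ[ℝ] (Fin p → ℝ) →ₗ[ℝ] ℝ :=
  Matrix.toLinearMap₂' ℝ M

/-- The averaging vector of the group of `a`. -/
noncomputable def avg (g : Fin p → Fin K) (a : Fin p) : Fin p → ℝ := partnershipMatrix g a

/-- The deviation of `a` from the average of its group. -/
noncomputable def dev (g : Fin p → Fin K) (a : Fin p) : Fin p → ℝ := Pi.single a 1 - avg g a

lemma card_group_pos (a : Fin p) : 0 < (group g (g a)).card :=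
  Finset.card_pos.2 ⟨a, by simp [group]⟩

lemma partnership_symm (a b : Fin p) : partnershipMatrix g a b = partnershipMatrix g b a := by
  by_cases h : g a = g b
  · simp [partnershipMatrix, h]
  · simp [partnershipMatrix, h, Ne.symm h]

lemma partnership_nonneg (a b : Fin p) : 0 ≤ partnershipMatrix g a b := by
  simp only [partnershipMatrix, Matrix.of_apply]; split_ifs <;> positivity

lemma partnership_row_sum (a : Fin p) : ∑ b, partnershipMatrix g a b = 1 := by
  have h : ∀ b, partnershipMatrix g a b
      = if b ∈ group g (g a) then 1 / ((group g (g a)).card : ℝ) else 0 := fun b => by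
    simp [partnershipMatrix, group, eq_comm]
  simp_rw [h]
  rw [Finset.sum_ite_mem, Finset.univ_inter, Finset.sum_const, nsmul_eq_mul]
  have := card_group_pos (g := g) a
  field_simp

lemma partnership_col_sum (b : Fin p) : ∑ a, partnershipMatrix g a b = 1 := by
  simp_rw [fun a => partnership_symm (g := g) a b]; exact partnership_row_sum b

lemma avg_congr {a b : Fin p} (h : g a = g b) : avg g a = avg g b := by
  funext c; simp [avg, partnershipMatrix, h]

lemma partnership_mul_congr {f : Fin p → Fin p → ℝ} (a b : Fin p)
    (h : g a = g b → f a b = f b b) :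
    partnershipMatrix g a b * f a b = partnershipMatrix g a b * f b b := by
  by_cases hab : g a = g b
  · rw [h hab]
  · simp [partnershipMatrix, hab]

lemma partnership_mul_self : partnershipMatrix g * partnershipMatrix g = partnershipMatrix g := by
  ext a b
  rw [Matrix.mul_apply]
  have : ∀ c, partnershipMatrix g a c * partnershipMatrix g c b
      = partnershipMatrix g a c * partnershipMatrix g a b := fun c => by
    by_cases hac : g a = g c
    · rw [show partnershipMatrix g c b = partnershipMatrix g a b from
        congrFun (avg_congr hac.symm) b]
    · simp [partnershipMatrix, hac]
  simp_rw [this, ← Finset.sum_mul, partnership_row_sum, one_mul]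

lemma partnership_trace (hg : ∀ k, 0 < (group g k).card) :
    (partnershipMatrix g).trace = K := by
  simp only [Matrix.trace, Matrix.diag, partnershipMatrix, Matrix.of_apply, if_true]
  rw [← Finset.sum_fiberwise (s := Finset.univ) (g := g)]
  have : ∀ k, ∑ a with g a = k, 1 / ((group g (g a)).card : ℝ) = 1 := fun k => by
    rw [Finset.sum_congr rfl (g := fun _ => 1 / ((group g k).card : ℝ))
      (fun a ha => by rw [(Finset.mem_filter.1 ha).2])]
    rw [Finset.sum_const, nsmul_eq_mul]
    have := hg k
    change ((group g k).card : ℝ) * _ = 1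
    field_simp
  rw [Finset.sum_congr rfl fun k _ => this k]; simp

lemma avg_eq_sum (a : Fin p) :
    avg g a = ∑ b, partnershipMatrix g a b • (Pi.single b 1 : Fin p → ℝ) := by
  funext c; simp [avg, Finset.sum_apply, Pi.single_apply]

lemma single_eq (a : Fin p) : (Pi.single a 1 : Fin p → ℝ) = avg g a + dev g a := by
  simp [dev]

/-- Inside a group the average is constant while the deviations sum to zero. -/
lemma sum_bilin_avg_dev (F : (Fin p → ℝ) →ₗ[ℝ] (Fin p → ℝ) →ₗ[ℝ] ℝ) :
    ∑ b, F (avg g b) (dev g b) = 0 := by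
  have h : ∑ b, F (avg g b) (avg g b) = ∑ b, F (avg g b) (Pi.single b 1) := by
    calc ∑ b, F (avg g b) (avg g b)
        = ∑ b, ∑ c, partnershipMatrix g b c * F (avg g c) (Pi.single c 1) := by
          refine Finset.sum_congr rfl fun b _ => ?_
          refine (congrArg (F (avg g b)) (avg_eq_sum (g := g) b)).trans ?_
          rw [map_sum]
          refine Finset.sum_congr rfl fun c _ => ?_
          rw [map_smul, smul_eq_mul]
          exact partnership_mul_congr (f := fun b c => F (avg g b) (Pi.single c 1)) b c
            fun h => by rw [avg_congr h]
      _ = _ := by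
          rw [Finset.sum_comm]
          simp_rw [← Finset.sum_mul, partnership_col_sum, one_mul]
  simp only [dev, map_sub, Finset.sum_sub_distrib, h, sub_self]

lemma frobInner_eq_sum_bilin (M B : Matrix (Fin p) (Fin p) ℝ) :
    frobInner M B = ∑ a, ∑ b, B a b * bilin M (Pi.single a 1) (Pi.single b 1) := by
  simp only [frobInner, bilin, Matrix.toLinearMap₂'_apply', Matrix.mulVec_single_one,
    single_one_dotProduct, Matrix.col_apply, mul_comm]

lemma bilin_comm {M : Matrix (Fin p) (Fin p) ℝ} (hM : M.IsSymm) (u v : Fin p → ℝ) :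
    bilin M u v = bilin M v u := by
  rw [bilin, Matrix.toLinearMap₂'_apply', Matrix.toLinearMap₂'_apply', Matrix.dotProduct_mulVec,
    ← Matrix.mulVec_transpose, hM.eq, dotProduct_comm]

/-- The Frobenius product with a matrix with unit row sums, in terms of the group averages and of
the deviations from them. -/
lemma frobInner_expand {M B : Matrix (Fin p) (Fin p) ℝ} (hM : M.IsSymm) (hB : B.IsSymm)
    (hsum : ∀ b, ∑ a, B a b = 1) :
    frobInner M B = ∑ a, bilin M (avg g a) (avg g a)
      - ∑ a, ∑ b, B a b * (bilin M (avg g a - avg g b) (avg g a - avg g b) / 2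
          - 2 * bilin M (avg g a - avg g b) (dev g b))
      + ∑ a, ∑ b, B a b * bilin M (dev g a) (dev g b) := by
  have hB' : ∀ a b, B a b = B b a := fun a b => hB.apply b a
  have hsum' : ∀ a, ∑ b, B a b = 1 := fun a => by simp_rw [fun b => hB' a b]; exact hsum a
  set F := bilin M with hF
  -- Of the terms outside the stated formula, F(avg_b, dev_b) sums to zero once the weights in a sum
  -- to 1, and the difference F(avg_b, dev_a) − F(avg_a, dev_b) is antisymmetric, so it cancels
  -- against the symmetric B.
  have key : ∀ a b, F (Pi.single a 1) (Pi.single b 1)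
      = F (avg g a) (avg g a) / 2 + F (avg g b) (avg g b) / 2
        - (F (avg g a - avg g b) (avg g a - avg g b) / 2
          - 2 * F (avg g a - avg g b) (dev g b))
        + F (dev g a) (dev g b) + F (avg g b) (dev g b)
        + (F (avg g b) (dev g a) - F (avg g a) (dev g b) + F (avg g b) (dev g b)) := fun a b => by
    rw [single_eq (g := g) a, single_eq (g := g) b]
    simp only [map_add, map_sub, LinearMap.add_apply, LinearMap.sub_apply]
    rw [bilin_comm hM (avg g b) (avg g a), bilin_comm hM (dev g a) (avg g b)]
    ring
  have e1 : ∀ f : Fin p → ℝ, ∑ a, ∑ b, B a b * f a = ∑ a, f a := fun f => by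
    simp_rw [← Finset.sum_mul, hsum', one_mul]
  have e2 : ∀ f : Fin p → ℝ, ∑ a, ∑ b, B a b * f b = ∑ b, f b := fun f => by
    rw [Finset.sum_comm]; simp_rw [← Finset.sum_mul, hsum, one_mul]
  have e3 : ∑ a, ∑ b, B a b * F (avg g b) (dev g a) = ∑ a, ∑ b, B a b * F (avg g a) (dev g b) := by
    rw [Finset.sum_comm]
    exact Finset.sum_congr rfl fun a _ => Finset.sum_congr rfl fun b _ => by rw [hB' b a]
  rw [frobInner_eq_sum_bilin]
  simp only [← hF, key, mul_add, mul_sub, Finset.sum_add_distrib, Finset.sum_sub_distrib]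
  rw [e3, e1 (fun a => F (avg g a) (avg g a) / 2), e2 (fun a => F (avg g a) (avg g a) / 2),
    e2 (fun b => F (avg g b) (dev g b)), hF, sum_bilin_avg_dev, ← Finset.sum_div]
  ring

lemma partnership_isSymm : (partnershipMatrix g).IsSymm := by
  ext a b; exact partnership_symm b a

lemma frobInner_partnership {M : Matrix (Fin p) (Fin p) ℝ} (hM : M.IsSymm) :
    frobInner M (partnershipMatrix g) = ∑ a, bilin M (avg g a) (avg g a) := by
  have h : ∀ a, bilin M (Pi.single a 1) (avg g a)
      = ∑ b, partnershipMatrix g a b * bilin M (Pi.single a 1) (Pi.single b 1) := fun a => by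
    conv_lhs => rw [avg_eq_sum (g := g) a]
    simp [map_sum]
  rw [frobInner_eq_sum_bilin]
  simp_rw [← h]
  have h2 : ∀ a, bilin M (Pi.single a 1) (avg g a)
      = bilin M (avg g a) (avg g a) + bilin M (avg g a) (dev g a) := fun a => by
    rw [single_eq (g := g) a, map_add, LinearMap.add_apply, bilin_comm hM (dev g a)]
  simp_rw [h2, Finset.sum_add_distrib, sum_bilin_avg_dev, add_zero]

lemma bilin_one (u v : Fin p → ℝ) : bilin (1 : Matrix (Fin p) (Fin p) ℝ) u v = u ⬝ᵥ v := by
  rw [bilin, Matrix.toLinearMap₂'_apply', Matrix.one_mulVec]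

lemma frobInner_one (B : Matrix (Fin p) (Fin p) ℝ) : frobInner 1 B = B.trace := by
  simp [frobInner, Matrix.one_apply, Matrix.trace]

lemma avg_dot_avg (a b : Fin p) : avg g a ⬝ᵥ avg g b = partnershipMatrix g a b := by
  conv_rhs => rw [← partnership_mul_self]
  rw [Matrix.mul_apply]
  exact Finset.sum_congr rfl fun c _ => by rw [partnership_symm c b]; rfl

lemma avg_dot_dev (a b : Fin p) : avg g a ⬝ᵥ dev g b = 0 := by
  rw [dev, dotProduct_sub, avg_dot_avg, dotProduct_single]
  simp [avg]

lemma partnership_mulVec (x : Fin p → ℝ) (a : Fin p) : (partnershipMatrix g *ᵥ x) a = avg g a ⬝ᵥ x :=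
  rfl

lemma partnership_mulVec_dev (b : Fin p) : partnershipMatrix g *ᵥ dev g b = 0 := by
  funext a; rw [partnership_mulVec, avg_dot_dev]; rfl

lemma avg_sub_dot_self_le {m : ℝ} (hm : 0 < m) (hmin : ∀ k, m ≤ (group g k).card) (a b : Fin p) :
    (avg g a - avg g b) ⬝ᵥ (avg g a - avg g b) ≤ if g a = g b then 0 else 2 / m := by
  split_ifs with h
  · simp [avg_congr h]
  · have hd : ∀ a, partnershipMatrix g a a ≤ 1 / m := fun a => by
      simp only [partnershipMatrix, Matrix.of_apply, if_true]
      exact one_div_le_one_div_of_le hm (hmin _)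
    have h0 : partnershipMatrix g a b = 0 := by simp [partnershipMatrix, h]
    have h1 : partnershipMatrix g b a = 0 := by rw [partnership_symm, h0]
    simp only [sub_dotProduct, dotProduct_sub, avg_dot_avg, h0, h1]
    have := hd a; have := hd b
    rw [show 2 / m = 1 / m + 1 / m by ring]; linarith

/-- A positive semidefinite matrix is a Gram matrix, and its pairing with a bilinear form is a sum
of values of the quadratic form. -/
lemma exists_gram_of_posSemidef {B : Matrix (Fin p) (Fin p) ℝ} (hB : B.PosSemidef) :
    ∃ C : Matrix (Fin p) (Fin p) ℝ, B = Cᵀ * C ∧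
      ∀ (F : (Fin p → ℝ) →ₗ[ℝ] (Fin p → ℝ) →ₗ[ℝ] ℝ) (r : Fin p → Fin p → ℝ),
        ∑ a, ∑ b, B a b * F (r a) (r b)
          = ∑ i, F (∑ a, C i a • r a) (∑ a, C i a • r a) := by
  obtain ⟨C, hC⟩ : ∃ C : Matrix (Fin p) (Fin p) ℝ, B = Cᵀ * C := by
    open scoped MatrixOrder in
    obtain ⟨C, hC⟩ := CStarAlgebra.nonneg_iff_eq_star_mul_self.mp hB.nonneg
    exact ⟨C, by simpa [Matrix.star_eq_conjTranspose] using hC⟩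
  refine ⟨C, hC, fun F r => ?_⟩
  have hab : ∀ a b, B a b = ∑ i, C i a * C i b := fun a b => by
    rw [hC, Matrix.mul_apply]; simp
  calc ∑ a, ∑ b, B a b * F (r a) (r b)
      = ∑ a, ∑ b, ∑ i, C i b * (C i a * F (r a) (r b)) := by
        refine Finset.sum_congr rfl fun a _ => Finset.sum_congr rfl fun b _ => ?_
        rw [hab, Finset.sum_mul]
        exact Finset.sum_congr rfl fun i _ => by ring
    _ = ∑ i, ∑ b, ∑ a, C i b * (C i a * F (r a) (r b)) := by
        rw [Finset.sum_comm, Finset.sum_congr rfl fun b _ => Finset.sum_comm, Finset.sum_comm]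
    _ = _ := by
        simp only [map_sum, LinearMap.sum_apply, map_smul, LinearMap.smul_apply, smul_eq_mul,
          Finset.mul_sum]

lemma partnership_mem_sdpDomain (hg : ∀ k, 0 < (group g k).card) :
    partnershipMatrix g ∈ sdpDomain p K := by
  refine ⟨?_, partnership_col_sum, partnership_nonneg, partnership_trace hg⟩
  have : partnershipMatrix g = (partnershipMatrix g)ᴴ * partnershipMatrix g := by
    rw [Matrix.conjTranspose_eq_transpose_of_trivial, partnership_isSymm.eq, partnership_mul_self]
  rw [this]
  exact Matrix.posSemidef_conjTranspose_mul_self _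

/-- A feasible point that does not charge pairs from different groups is the partnership matrix. -/
lemma eq_partnership_of_forall_ne {B : Matrix (Fin p) (Fin p) ℝ} (hg : ∀ k, 0 < (group g k).card)
    (hB : B ∈ sdpDomain p K) (h0 : ∀ a b, g a ≠ g b → B a b = 0) : B = partnershipMatrix g := by
  obtain ⟨hpsd, hsum, -, htr⟩ := hB
  have hsymm : B.IsSymm := (Matrix.conjTranspose_eq_transpose_of_trivial B).symm.trans hpsd.isHermitian
  have hz : ∀ f : Fin p → Fin p → ℝ, (∀ a b, g a = g b → f a b = 0) →
      ∑ a, ∑ b, B a b * f a b = 0 := fun f hf =>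
    Finset.sum_eq_zero fun a _ => Finset.sum_eq_zero fun b _ => by
      by_cases h : g a = g b
      · rw [hf a b h, mul_zero]
      · rw [h0 a b h, zero_mul]
  -- With M = I the trace constraint forces Σ B_ab ⟨dev_a, dev_b⟩ = 0. In Gram form this is a sum of
  -- squared norms, so C, and then B, is fixed by right multiplication by the partnership matrix.
  have hexp := frobInner_expand (g := g) Matrix.isSymm_one hsymm hsum
  rw [hz _ fun a b h => by simp [avg_congr h], ← frobInner_partnership Matrix.isSymm_one,
    frobInner_one, frobInner_one, htr, partnership_trace hg] at hexp
  obtain ⟨C, hC, hF⟩ := exists_gram_of_posSemidef hpsd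
  rw [hF] at hexp
  simp only [bilin_one] at hexp
  have hx : ∀ i, ∑ a, C i a • dev g a = 0 := fun i => by
    have := (Finset.sum_eq_zero_iff_of_nonneg
      (f := fun i => (∑ a, C i a • dev g a) ⬝ᵥ (∑ a, C i a • dev g a))
      fun i _ => Finset.sum_nonneg fun _ _ => mul_self_nonneg _).1 (by linarith) i (Finset.mem_univ i)
    exact dotProduct_self_eq_zero.1 this
  have hCP : C * partnershipMatrix g = C := by
    ext i b
    have := congrFun (hx i) b
    simp only [dev, smul_sub, Finset.sum_sub_distrib, Pi.sub_apply, Finset.sum_apply, Pi.smul_apply,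
      smul_eq_mul, Pi.single_apply, mul_ite, mul_one, mul_zero, Finset.sum_ite_eq, Finset.mem_univ,
      if_true, Pi.zero_apply] at this
    rw [Matrix.mul_apply]
    exact (sub_eq_zero.1 this).symm
  have hBP : B * partnershipMatrix g = B := by rw [hC, Matrix.mul_assoc, hCP]
  ext a b
  rw [← hBP, Matrix.mul_apply]
  have : ∀ c, B a c * partnershipMatrix g c b = B a c * partnershipMatrix g a b := fun c => by
    by_cases h : g a = g c
    · rw [show partnershipMatrix g c b = partnershipMatrix g a b from congrFun (avg_congr h.symm) b]
    · rw [h0 a c h, zero_mul, zero_mul]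
  simp_rw [this, ← Finset.sum_mul, fun c => (hsymm.apply a c).symm, hsum, one_mul]

/-- The partnership matrix is the unique maximizer as soon as the matrix of the program separates
the groups. -/
theorem sdpArgmax_eq_of_separated {M : Matrix (Fin p) (Fin p) ℝ} (hM : M.IsSymm) {m κ : ℝ}
    (hm : 0 < m) (hmin : ∀ k, m ≤ (group g k).card) (hκ : 0 ≤ κ)
    (hquad : ∀ x, partnershipMatrix g *ᵥ x = 0 → bilin M x x ≤ κ * (x ⬝ᵥ x))
    (hsep : ∀ a b, g a ≠ g b → κ / m < bilin M (avg g a - avg g b) (avg g a - avg g b) / 2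
      - 2 * bilin M (avg g a - avg g b) (dev g b)) :
    sdpArgmax K M = {partnershipMatrix g} := by
  have hg : ∀ k, 0 < (group g k).card := fun k => by exact_mod_cast hm.trans_le (hmin k)
  have main : ∀ B ∈ sdpDomain p K, B ≠ partnershipMatrix g →
      frobInner M B < frobInner M (partnershipMatrix g) := by
    intro B hB hne
    obtain ⟨hpsd, hsum, hnn, htr⟩ := id hB
    have hsymm : B.IsSymm :=
      (Matrix.conjTranspose_eq_transpose_of_trivial B).symm.trans hpsd.isHermitian
    obtain ⟨a₀, b₀, hab, hpos⟩ : ∃ a b, g a ≠ g b ∧ 0 < B a b := by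
      by_contra! hcon
      exact hne (eq_partnership_of_forall_ne hg hB fun a b h => le_antisymm (hcon a b h) (hnn a b))
    -- The expansion at M = I: the trace constraint equates the weight of the deviations with that
    -- of the differences of averages.
    have h1 := frobInner_expand (g := g) Matrix.isSymm_one hsymm hsum
    rw [← frobInner_partnership Matrix.isSymm_one, frobInner_one, frobInner_one, htr,
      partnership_trace hg] at h1
    simp only [bilin_one, sub_dotProduct _ _ (dev g _), avg_dot_dev, sub_zero, mul_zero] at h1
    have hdev : ∑ a, ∑ b, B a b * bilin M (dev g a) (dev g b)
        ≤ κ * ∑ a, ∑ b, B a b * (dev g a ⬝ᵥ dev g b) := by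
      obtain ⟨C, -, hF⟩ := exists_gram_of_posSemidef hpsd
      have h2 := hF (bilin 1) (dev g)
      simp only [bilin_one] at h2
      rw [hF, h2, Finset.mul_sum]
      refine Finset.sum_le_sum fun i _ => hquad _ ?_
      rw [Matrix.mulVec_sum]
      exact Finset.sum_eq_zero fun a _ => by
        rw [Matrix.mulVec_smul, partnership_mulVec_dev, smul_zero]
    -- Pairs inside a group contribute zero to both sides; strictness comes from the charged pair
    -- (a₀, b₀).
    have hlt : ∑ a, ∑ b, B a b * (κ * ((avg g a - avg g b) ⬝ᵥ (avg g a - avg g b) / 2))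
        < ∑ a, ∑ b, B a b * (bilin M (avg g a - avg g b) (avg g a - avg g b) / 2
          - 2 * bilin M (avg g a - avg g b) (dev g b)) := by
      have hterm : ∀ a b, g a ≠ g b → κ * ((avg g a - avg g b) ⬝ᵥ (avg g a - avg g b) / 2)
          < bilin M (avg g a - avg g b) (avg g a - avg g b) / 2
            - 2 * bilin M (avg g a - avg g b) (dev g b) := fun a b h => by
        refine lt_of_le_of_lt ?_ (hsep a b h)
        have := avg_sub_dot_self_le (g := g) hm hmin a b
        rw [if_neg h] at this
        rw [div_eq_mul_one_div κ m]
        refine mul_le_mul_of_nonneg_left ?_ hκ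
        have e : 2 / m = 2 * (1 / m) := by ring
        linarith
      have hle : ∀ a b, B a b * (κ * ((avg g a - avg g b) ⬝ᵥ (avg g a - avg g b) / 2))
          ≤ B a b * (bilin M (avg g a - avg g b) (avg g a - avg g b) / 2
            - 2 * bilin M (avg g a - avg g b) (dev g b)) := fun a b => by
        by_cases h : g a = g b
        · simp [avg_congr h]
        · exact mul_le_mul_of_nonneg_left (hterm a b h).le (hnn a b)
      refine Finset.sum_lt_sum (fun a _ => Finset.sum_le_sum fun b _ => hle a b)
        ⟨a₀, Finset.mem_univ _, Finset.sum_lt_sum (fun b _ => hle a₀ b)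
          ⟨b₀, Finset.mem_univ _, mul_lt_mul_of_pos_left (hterm a₀ b₀ hab) hpos⟩⟩
    have hκsum : ∑ a, ∑ b, B a b * (κ * ((avg g a - avg g b) ⬝ᵥ (avg g a - avg g b) / 2))
        = κ * ∑ a, ∑ b, B a b * (dev g a ⬝ᵥ dev g b) := by
      rw [show ∑ a, ∑ b, B a b * (dev g a ⬝ᵥ dev g b)
        = ∑ a, ∑ b, B a b * ((avg g a - avg g b) ⬝ᵥ (avg g a - avg g b) / 2) by linarith]
      simp only [Finset.mul_sum, mul_left_comm κ]
    rw [frobInner_expand (g := g) hM hsymm hsum, frobInner_partnership hM]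
    linarith
  have hP := partnership_mem_sdpDomain hg
  ext B
  simp only [sdpArgmax, Set.mem_ofPred_eq, Set.mem_singleton_iff]
  constructor
  · rintro ⟨hB, hmax⟩
    by_contra hne
    exact (main B hB hne).not_ge (hmax _ hP)
  · rintro rfl
    refine ⟨hP, fun B hB => ?_⟩
    by_cases h : B = partnershipMatrix g
    · rw [h]
    · exact (main B hB h).le

/-- The trace is fixed on the domain. This is why only the variation of the diagonal error, not its
size, matters. -/
lemma sdpArgmax_add_smul_one (M : Matrix (Fin p) (Fin p) ℝ) (c : ℝ) :
    sdpArgmax K (M + c • 1) = sdpArgmax K M := by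
  have h : ∀ B ∈ sdpDomain p K, frobInner (M + c • 1) B = frobInner M B + c * K := fun B hB => by
    rw [← hB.2.2.2, ← frobInner_one]
    simp only [frobInner, Matrix.add_apply, Matrix.smul_apply, smul_eq_mul, add_mul,
      Finset.sum_add_distrib, Finset.mul_sum, mul_assoc]
  ext B
  simp only [sdpArgmax, Set.mem_ofPred_eq]
  refine and_congr_right fun hB => forall₂_congr fun B' hB' => ?_
  rw [h B hB, h B' hB']
  exact add_le_add_iff_right _

end Deterministic

/-! ### Concentration of empirical second moments of Gaussian variables -/

section ChiSquare

lemma integral_exp_sq_gaussianReal {s : ℝ} (hs : s < 1 / 2) :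
    ∫ x, Real.exp (s * x ^ 2) ∂(gaussianReal 0 1) = (√(1 - 2 * s))⁻¹ := by
  rw [integral_gaussianReal_eq_integral_smul one_ne_zero]
  have : ∀ x : ℝ, gaussianPDFReal 0 1 x • Real.exp (s * x ^ 2)
      = (√(2 * Real.pi))⁻¹ * Real.exp (-(1 / 2 - s) * x ^ 2) := fun x => by
    simp only [gaussianPDFReal, NNReal.coe_one, mul_one, sub_zero, smul_eq_mul]
    rw [mul_assoc, ← Real.exp_add]
    congr 2; ring
  simp_rw [this]
  rw [integral_const_mul, integral_gaussian, ← Real.sqrt_inv, ← Real.sqrt_inv,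
    ← Real.sqrt_mul (by positivity)]
  congr 1
  have : (1 / 2 - s) ≠ 0 := by linarith
  have : (1 - 2 * s) ≠ 0 := by linarith
  have := Real.pi_pos.ne'
  field_simp

lemma inv_sqrt_one_sub_le {s : ℝ} (hs : |s| ≤ 1 / 4) :
    (√(1 - 2 * s))⁻¹ ≤ Real.exp (s + 2 * s ^ 2) := by
  obtain ⟨h1, h2⟩ := abs_le.1 hs
  have hpos : 0 < 1 - 2 * s := by linarith
  have hexp : 1 ≤ (1 - 2 * s) * Real.exp (2 * s + 4 * s ^ 2) := by
    -- For s ≤ 0 the bound exp x ≥ 1 + x suffices, as (1 − 2s)(1 + 2s + 4s²) = 1 − 8s³ ≥ 1; for s ≥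
    -- 0 the quadratic term of the exponential is needed.
    rcases le_total s 0 with h | h
    · have h3 := mul_le_mul_of_nonneg_left (Real.add_one_le_exp (2 * s + 4 * s ^ 2)) hpos.le
      nlinarith [mul_nonneg (neg_nonneg.2 h) (sq_nonneg s)]
    · have h3 := mul_le_mul_of_nonneg_left
        (Real.quadratic_le_exp_of_nonneg (x := 2 * s + 4 * s ^ 2) (by positivity)) hpos.le
      have h4 : 0 ≤ s ^ 2 * ((1 - 2 * s) * (1 + 2 * s) ^ 2 - 4 * s) := by
        refine mul_nonneg (sq_nonneg s) ?_
        nlinarith [mul_nonneg h (sub_nonneg.2 h2), mul_nonneg (mul_nonneg h h) (sub_nonneg.2 h2)]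
      nlinarith
  rw [← Real.sqrt_inv, Real.sqrt_le_left (Real.exp_pos _).le, ← Real.exp_nat_mul,
    inv_le_iff_one_le_mul₀' hpos]
  rw [show ((2 : ℕ) : ℝ) * (s + 2 * s ^ 2) = 2 * s + 4 * s ^ 2 by push_cast; ring]
  exact hexp

variable {Ω : Type*} [MeasurableSpace Ω] {P : Measure Ω} [IsProbabilityMeasure P] {n : ℕ}

/-- Chernoff bound for the sum of the centered squares of independent standard Gaussian
variables. -/
lemma measure_le_sum_sq_sub_one {Y : Fin n → Ω → ℝ} (hind : iIndepFun Y P)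
    (hY : ∀ i, HasLaw (Y i) (gaussianReal 0 1) P) {s : ℝ} (hs : |s| ≤ 1 / 4) {ε : ℝ} :
    P.real {ω | ε ≤ s * ∑ i, (Y i ω ^ 2 - 1)} ≤ Real.exp (2 * n * s ^ 2 - ε) := by
  have hs2 : s < 1 / 2 := by linarith [(abs_le.1 hs).2]
  let U : Fin n → Ω → ℝ := fun i ω => s * (Y i ω ^ 2 - 1)
  have hmeas : ∀ i, AEMeasurable (U i) P := fun i => by
    have := (hY i).aemeasurable
    fun_prop
  have hU : iIndepFun U P := hind.comp (fun _ y => s * (y ^ 2 - 1)) (fun _ => by fun_prop)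
  have hmgf : ∀ i, mgf (U i) P 1 = Real.exp (-s) * (√(1 - 2 * s))⁻¹ := fun i => by
    rw [← integral_exp_sq_gaussianReal hs2, ← (hY i).map_eq, integral_map (hY i).aemeasurable
      (by fun_prop), ← integral_const_mul, mgf]
    refine integral_congr_ae (ae_of_all _ fun ω => ?_)
    simp only [U]
    rw [← Real.exp_add]; congr 1; ring
  have hsum := hU.mgf_sum₀ (t := 1) hmeas Finset.univ
  have hpos : 0 < √(1 - 2 * s) := Real.sqrt_pos.2 (by linarith)
  simp_rw [hmgf, Finset.prod_const] at hsum
  -- A non-integrable exponential would have `mgf` equal to the default value 0, whereas the product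
  -- formula makes it positive.
  have hint : Integrable (fun ω => Real.exp (1 * (∑ i, U i) ω)) P := by
    by_contra h
    have : mgf (∑ i, U i) P 1 = 0 := integral_undef h
    rw [this] at hsum
    exact absurd hsum.symm (by positivity)
  have h := measure_ge_le_exp_mul_mgf ε zero_le_one hint
  have hset : {ω | ε ≤ s * ∑ i, (Y i ω ^ 2 - 1)} = {ω | ε ≤ (∑ i, U i) ω} := by
    ext ω; simp only [Set.mem_ofPred_eq, U, Finset.mul_sum, Finset.sum_apply]
  rw [hset]
  refine h.trans ?_
  rw [hsum, Finset.card_univ, Fintype.card_fin]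
  have h1 : Real.exp (-s) * (√(1 - 2 * s))⁻¹ ≤ Real.exp (2 * s ^ 2) := by
    calc _ ≤ Real.exp (-s) * Real.exp (s + 2 * s ^ 2) := by gcongr; exact inv_sqrt_one_sub_le hs
      _ = _ := by rw [← Real.exp_add]; congr 1; ring
  calc Real.exp (-1 * ε) * (Real.exp (-s) * (√(1 - 2 * s))⁻¹) ^ n
      ≤ Real.exp (-1 * ε) * Real.exp (2 * s ^ 2) ^ n := by gcongr
    _ = _ := by rw [← Real.exp_nat_mul, ← Real.exp_add]; congr 1; ring

/-- The deviation rate `r + r²` at `r = √(t / n)`. -/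
noncomputable def devRate (n : ℕ) (t : ℝ) : ℝ := √(t / n) + t / n

lemma devRate_nonneg {n : ℕ} {t : ℝ} (ht : 0 ≤ t) : 0 ≤ devRate n t := by
  unfold devRate; positivity

/-- Two-sided deviations of the sum of squares of independent standard Gaussian variables. -/
lemma measure_abs_sum_sq_sub_one (hn : 0 < n) {Y : Fin n → Ω → ℝ} (hind : iIndepFun Y P)
    (hY : ∀ i, HasLaw (Y i) (gaussianReal 0 1) P) {t : ℝ} (ht : 0 ≤ t) :
    P.real {ω | 8 * n * devRate n t < |∑ i, (Y i ω ^ 2 - 1)|} ≤ 2 * Real.exp (-t) := by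
  have hn' : (0 : ℝ) < n := by exact_mod_cast hn
  set r := √(t / n) with hr
  have hr0 : 0 ≤ r := Real.sqrt_nonneg _
  have hrt : t = n * r ^ 2 := by
    rw [hr, Real.sq_sqrt (by positivity)]; field_simp
  have hD : devRate n t = r + r ^ 2 := by rw [devRate, hr, Real.sq_sqrt (by positivity)]
  -- Take s = min(r, 1/4): the Gaussian regime uses s = r, the exponential regime the largest s
  -- allowed by the Chernoff bound.
  obtain ⟨s, hs0, hs, hst⟩ : ∃ s : ℝ, 0 ≤ s ∧ s ≤ 1 / 4 ∧
      2 * n * s ^ 2 - s * (8 * n * devRate n t) ≤ -t := by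
    rw [hD, hrt]
    rcases le_total r (1 / 4) with h | h
    · refine ⟨r, hr0, h, ?_⟩
      have : 0 ≤ n * r ^ 2 := by positivity
      have : 0 ≤ n * r ^ 3 := by positivity
      nlinarith
    · refine ⟨1 / 4, by norm_num, le_rfl, ?_⟩
      have : 0 ≤ n * r ^ 2 := by positivity
      have : n * (1 / 4) ≤ n * r := by gcongr
      nlinarith
  have h1 := measure_le_sum_sq_sub_one hind hY (s := s) (ε := s * (8 * n * devRate n t))
    (by rwa [abs_of_nonneg hs0])
  have h2 := measure_le_sum_sq_sub_one hind hY (s := -s) (ε := s * (8 * n * devRate n t))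
    (by rwa [abs_neg, abs_of_nonneg hs0])
  have hsub : {ω | 8 * n * devRate n t < |∑ i, (Y i ω ^ 2 - 1)|} ⊆
      {ω | s * (8 * n * devRate n t) ≤ s * ∑ i, (Y i ω ^ 2 - 1)} ∪
      {ω | s * (8 * n * devRate n t) ≤ -s * ∑ i, (Y i ω ^ 2 - 1)} := by
    intro ω hω
    rcases lt_abs.1 (Set.mem_ofPred_eq ▸ hω) with h | h
    · exact Or.inl (mul_le_mul_of_nonneg_left h.le hs0)
    · refine Or.inr ?_
      change _ ≤ -s * _
      rw [neg_mul, ← mul_neg]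
      exact mul_le_mul_of_nonneg_left h.le hs0
  refine (measureReal_mono hsub).trans ((measureReal_union_le _ _).trans ?_)
  have e1 := Real.exp_le_exp.2 hst
  rw [neg_sq] at h2
  linarith

end ChiSquare

/-! ### Deviations of the sample covariance matrix -/

section SampleCov

variable {p n : ℕ}

lemma bilin_sampleCov (x : Fin n → Fin p → ℝ) (u v : Fin p → ℝ) :
    bilin (sampleCov x) u v = (1 / n : ℝ) * ∑ i, (u ⬝ᵥ x i) * (v ⬝ᵥ x i) := by
  have h : ∀ i, (u ⬝ᵥ x i) * (v ⬝ᵥ x i) = ∑ a, ∑ b, u a * (x i a * x i b * v b) := fun i => by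
    simp only [dotProduct, Finset.sum_mul_sum]
    exact Finset.sum_congr rfl fun a _ => Finset.sum_congr rfl fun b _ => by ring
  rw [bilin, Matrix.toLinearMap₂'_apply', Finset.sum_congr rfl fun i _ => h i, Finset.sum_comm,
    Finset.mul_sum]
  simp only [dotProduct, Matrix.mulVec, sampleCov, Matrix.of_apply, Finset.mul_sum, Finset.sum_mul]
  refine Finset.sum_congr rfl fun a _ => ?_
  rw [Finset.sum_comm]
  exact Finset.sum_congr rfl fun i _ => Finset.sum_congr rfl fun b _ => by ring

variable {Ω₀ : Type*} [MeasurableSpace Ω₀] {P₀ : Measure Ω₀} {X : Ω₀ → Fin p → ℝ}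

lemma memLp_apply_of_hasGaussianLaw (hX : HasGaussianLaw X P₀) (a : Fin p) :
    MemLp (fun ω => X ω a) 2 P₀ :=
  (hX.map_fun (ContinuousLinearMap.proj (R := ℝ) (φ := fun _ : Fin p => ℝ) a)).memLp_two

lemma covMatrix_isSymm (P : Measure Ω₀) (Y : Ω₀ → Fin p → ℝ) : (covMatrix P Y).IsSymm := by
  ext a b; exact covariance_comm _ _

lemma sampleCov_isSymm (x : Fin n → Fin p → ℝ) : (sampleCov x).IsSymm := by
  ext a b; simp [sampleCov, mul_comm]

variable [IsProbabilityMeasure P₀]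

lemma bilin_covMatrix (hX : ∀ a, MemLp (fun ω => X ω a) 2 P₀) (u v : Fin p → ℝ) :
    bilin (covMatrix P₀ X) u v = cov[fun ω => u ⬝ᵥ X ω, fun ω => v ⬝ᵥ X ω; P₀] := by
  simp only [dotProduct]
  rw [covariance_fun_sum_fun_sum (fun i => (hX i).const_mul (u i))
    (fun i => (hX i).const_mul (v i)), bilin, Matrix.toLinearMap₂'_apply']
  simp only [dotProduct, Matrix.mulVec, Finset.mul_sum]
  refine Finset.sum_congr rfl fun a _ => Finset.sum_congr rfl fun b _ => ?_
  rw [covariance_const_mul_left, covariance_const_mul_right]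
  simp only [covMatrix, Matrix.of_apply]
  ring

lemma bilin_covMatrix_self (hX : ∀ a, MemLp (fun ω => X ω a) 2 P₀) (u : Fin p → ℝ) :
    bilin (covMatrix P₀ X) u u = Var[fun ω => u ⬝ᵥ X ω; P₀] := by
  rw [bilin_covMatrix hX, covariance_self]
  have := fun a => (hX a).aemeasurable
  simp only [dotProduct]
  fun_prop

variable {Ω : Type*} [MeasurableSpace Ω] {P : Measure Ω} {Xobs : Fin n → Ω → Fin p → ℝ}

lemma hasLaw_dotProduct (hX : HasGaussianLaw X P₀) (hmean : ∀ a, ∫ ω, X ω a ∂P₀ = 0)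
    {Y : Ω → Fin p → ℝ} (hY : IdentDistrib Y X P P₀) (u : Fin p → ℝ) :
    HasLaw (fun ω => u ⬝ᵥ Y ω)
      (gaussianReal 0 (bilin (covMatrix P₀ X) u u).toNNReal) P := by
  have hL := memLp_apply_of_hasGaussianLaw hX
  have hg : HasGaussianLaw (fun ω => u ⬝ᵥ X ω) P₀ := by
    refine (hX.map_fun (∑ a, u a • ContinuousLinearMap.proj (R := ℝ) (φ := fun _ : Fin p => ℝ) a)).congr
      (ae_of_all _ fun ω => ?_)
    simp [dotProduct]
  have hm : ∫ ω, u ⬝ᵥ X ω ∂P₀ = 0 := by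
    simp only [dotProduct]
    rw [integral_finsetSum _ fun a _ => ((hL a).integrable one_le_two).const_mul _]
    simp [integral_const_mul, hmean]
  have hlaw : HasLaw (fun ω => u ⬝ᵥ X ω)
      (gaussianReal 0 (bilin (covMatrix P₀ X) u u).toNNReal) P₀ := by
    refine ⟨hg.aemeasurable, ?_⟩
    rw [hg.map_eq_gaussianReal, hm, bilin_covMatrix_self hL]
  have hmeas : Measurable fun y : Fin p → ℝ => u ⬝ᵥ y := by
    simp only [dotProduct]; fun_prop
  exact (hY.comp hmeas).symm.hasLaw hlaw

lemma bilin_covMatrix_self_nonneg (hX : ∀ a, MemLp (fun ω => X ω a) 2 P₀) (u : Fin p → ℝ) :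
    0 ≤ bilin (covMatrix P₀ X) u u := by
  rw [bilin_covMatrix_self hX]; exact variance_nonneg _ _

lemma ae_dotProduct_eq_zero (hX : HasGaussianLaw X P₀) (hmean : ∀ a, ∫ ω, X ω a ∂P₀ = 0)
    (hY : ∀ i, IdentDistrib (Xobs i) X P P₀) {u : Fin p → ℝ}
    (hu : bilin (covMatrix P₀ X) u u = 0) : ∀ᵐ ω ∂P, ∀ i, u ⬝ᵥ Xobs i ω = 0 := by
  rw [ae_all_iff]
  intro i
  have h := hasLaw_dotProduct hX hmean (hY i) u
  rw [hu, Real.toNNReal_zero, gaussianReal_zero_var] at h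
  have h2 : ∀ᵐ y ∂(P.map fun ω => u ⬝ᵥ Xobs i ω), y = 0 := by
    rw [h.map_eq]
    exact (ae_dirac_iff (p := fun y => y = 0) (measurableSet_singleton 0)).2 rfl
  exact ae_of_ae_map h.aemeasurable h2

variable [IsProbabilityMeasure P]

/-- Deviations of the empirical variance of a linear functional. -/
lemma measure_abs_bilin_self (hn : 0 < n) (hX : HasGaussianLaw X P₀)
    (hmean : ∀ a, ∫ ω, X ω a ∂P₀ = 0) (hind : iIndepFun Xobs P)
    (hY : ∀ i, IdentDistrib (Xobs i) X P P₀) {t : ℝ} (ht : 0 ≤ t) (u : Fin p → ℝ) :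
    P.real {ω | 8 * bilin (covMatrix P₀ X) u u * devRate n t
      < |bilin (sampleCov (fun i => Xobs i ω) - covMatrix P₀ X) u u|} ≤ 2 * Real.exp (-t) := by
  have hn' : (0 : ℝ) < n := by exact_mod_cast hn
  have hv := bilin_covMatrix_self_nonneg (memLp_apply_of_hasGaussianLaw hX) u
  set v := bilin (covMatrix P₀ X) u u with hvdef
  -- A zero variance cannot be normalized, but then the functional vanishes almost surely on every
  -- observation.
  rcases hv.eq_or_lt with hv0 | hv0
  · have hae := ae_dotProduct_eq_zero hX hmean hY (u := u) hv0.symm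
    have : P.real {ω | 8 * v * devRate n t
        < |bilin (sampleCov (fun i => Xobs i ω) - covMatrix P₀ X) u u|} = 0 := by
      rw [measureReal_eq_zero_iff]
      refine measure_mono_null ?_ (ae_iff.1 hae)
      intro ω hω h0
      simp only [Set.mem_ofPred_eq, map_sub, LinearMap.sub_apply, bilin_sampleCov, h0, ← hvdef,
        ← hv0] at hω
      simp at hω
    rw [this]; positivity
  · have hs : 0 < √v := Real.sqrt_pos.2 hv0
    have hsq : √v ^ 2 = v := Real.sq_sqrt hv
    have hlaw : ∀ i, HasLaw (fun ω => (u ⬝ᵥ Xobs i ω) / √v) (gaussianReal 0 1) P := fun i => by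
      have := gaussianReal_div_const (hasLaw_dotProduct hX hmean (hY i) u) (√v)
      rw [zero_div, ← hvdef] at this
      convert this using 2
      rw [← NNReal.coe_inj]
      simp only [NNReal.coe_one, NNReal.coe_div, Real.coe_toNNReal _ hv, NNReal.coe_mk]
      rw [hsq, div_self hv0.ne']
    have hmeas : Measurable fun y : Fin p → ℝ => (u ⬝ᵥ y) / √v := by
      simp only [dotProduct]; fun_prop
    have hind' : iIndepFun (fun i ω => (u ⬝ᵥ Xobs i ω) / √v) P :=
      hind.comp (fun _ y => (u ⬝ᵥ y) / √v) fun _ => hmeas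
    refine le_trans (measureReal_mono ?_) (measure_abs_sum_sq_sub_one hn hind' hlaw ht)
    intro ω hω
    simp only [Set.mem_ofPred_eq] at hω ⊢
    have e : ∑ i, (((u ⬝ᵥ Xobs i ω) / √v) ^ 2 - 1)
        = n / v * bilin (sampleCov (fun i => Xobs i ω) - covMatrix P₀ X) u u := by
      rw [Finset.sum_congr rfl fun i _ => by rw [div_pow, hsq], Finset.sum_sub_distrib,
        ← Finset.sum_div]
      simp only [map_sub, LinearMap.sub_apply, bilin_sampleCov, ← hvdef, ← pow_two, Finset.sum_const, Finset.card_univ, Fintype.card_fin, nsmul_eq_mul]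
      field_simp
    rw [e, abs_mul, abs_of_pos (by positivity), div_mul_eq_mul_div, lt_div_iff₀ hv0]
    calc 8 * n * devRate n t * v = n * (8 * v * devRate n t) := by ring
      _ < _ := mul_lt_mul_of_pos_left hω hn'

/-- Deviations of the empirical covariance of two linear functionals. -/
lemma measure_abs_bilin (hn : 0 < n) (hX : HasGaussianLaw X P₀)
    (hmean : ∀ a, ∫ ω, X ω a ∂P₀ = 0) (hind : iIndepFun Xobs P)
    (hY : ∀ i, IdentDistrib (Xobs i) X P P₀) {t : ℝ} (ht : 0 ≤ t) {u v : Fin p → ℝ} {α β : ℝ}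
    (hα : 0 ≤ α) (hβ : 0 ≤ β) (hu : bilin (covMatrix P₀ X) u u ≤ α ^ 2)
    (hv : bilin (covMatrix P₀ X) v v ≤ β ^ 2) :
    P.real {ω | 8 * (α * β) * devRate n t
      < |bilin (sampleCov (fun i => Xobs i ω) - covMatrix P₀ X) u v|} ≤ 4 * Real.exp (-t) := by
  have hL := memLp_apply_of_hasGaussianLaw hX
  have hsymm := covMatrix_isSymm P₀ X
  have hnn := bilin_covMatrix_self_nonneg hL
  have hdeg : ∀ {u v : Fin p → ℝ}, bilin (covMatrix P₀ X) u u = 0 →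
      ∀ᵐ ω ∂P, bilin (sampleCov (fun i => Xobs i ω) - covMatrix P₀ X) u v = 0 := by
    intro u v hu
    have hcs : bilin (covMatrix P₀ X) u v = 0 := by
      by_contra hne
      -- The variance along v + s u is affine in s when that along u is zero; this s would make it
      -- equal to −1.
      obtain ⟨s, hs⟩ : ∃ s, s * bilin (covMatrix P₀ X) u v
          = -(bilin (covMatrix P₀ X) v v + 1) / 2 := ⟨_, div_mul_cancel₀ _ hne⟩
      have h := hnn (v + s • u)
      simp only [map_add, map_smul, LinearMap.add_apply, LinearMap.smul_apply, smul_eq_mul, hu,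
        bilin_comm hsymm v u, mul_zero, add_zero] at h
      linarith
    filter_upwards [ae_dotProduct_eq_zero hX hmean hY hu] with ω hω
    simp only [map_sub, LinearMap.sub_apply, bilin_sampleCov, hω, hcs]
    simp
  have hnull : (∀ᵐ ω ∂P, bilin (sampleCov (fun i => Xobs i ω) - covMatrix P₀ X) u v = 0) →
      P.real {ω | 8 * (α * β) * devRate n t
      < |bilin (sampleCov (fun i => Xobs i ω) - covMatrix P₀ X) u v|} ≤ 4 * Real.exp (-t) := by
    intro hae
    have : P.real {ω | 8 * (α * β) * devRate n t
        < |bilin (sampleCov (fun i => Xobs i ω) - covMatrix P₀ X) u v|} = 0 := by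
      rw [measureReal_eq_zero_iff]
      refine measure_mono_null ?_ (ae_iff.1 hae)
      intro ω hω h0
      rw [Set.mem_ofPred_eq, h0, abs_zero] at hω
      have := devRate_nonneg (n := n) ht
      exact hω.not_ge (by positivity)
    rw [this]; positivity
  rcases hα.eq_or_lt with rfl | hα0
  · exact hnull (hdeg (le_antisymm (by simpa using hu) (hnn u)))
  rcases hβ.eq_or_lt with rfl | hβ0
  · refine hnull ?_
    filter_upwards [hdeg (u := v) (v := u) (le_antisymm (by simpa using hv) (hnn v))] with ω hω
    rw [bilin_comm ((sampleCov_isSymm _).sub hsymm), hω]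
  -- Polarization at u/α ± v/β: by the parallelogram identity the two variances add up to at most 4,
  -- and each sign fails with probability at most 2 exp(−t).
  have h1 := measure_abs_bilin_self hn hX hmean hind hY ht (α⁻¹ • u + β⁻¹ • v)
  have h2 := measure_abs_bilin_self hn hX hmean hind hY ht (α⁻¹ • u - β⁻¹ • v)
  have hpar : bilin (covMatrix P₀ X) (α⁻¹ • u + β⁻¹ • v) (α⁻¹ • u + β⁻¹ • v)
      + bilin (covMatrix P₀ X) (α⁻¹ • u - β⁻¹ • v) (α⁻¹ • u - β⁻¹ • v) ≤ 4 := by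
    have e1 : (α⁻¹) ^ 2 * bilin (covMatrix P₀ X) u u ≤ 1 := by
      rw [inv_pow, inv_mul_le_iff₀ (by positivity)]; linarith
    have e2 : (β⁻¹) ^ 2 * bilin (covMatrix P₀ X) v v ≤ 1 := by
      rw [inv_pow, inv_mul_le_iff₀ (by positivity)]; linarith
    simp only [map_add, map_sub, map_smul, LinearMap.add_apply, LinearMap.sub_apply,
      LinearMap.smul_apply, smul_eq_mul]
    linarith
  refine le_trans (measureReal_mono (s₂ := _ ∪ _) ?_)
    ((measureReal_union_le _ _).trans ((add_le_add h1 h2).trans (by linarith)))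
  intro ω hω
  by_contra hcon
  simp only [Set.mem_union, Set.mem_ofPred_eq, not_or, not_lt] at hcon hω
  obtain ⟨c1, c2⟩ := hcon
  set N := sampleCov (fun i => Xobs i ω) - covMatrix P₀ X with hN
  have hpol : bilin N (α⁻¹ • u + β⁻¹ • v) (α⁻¹ • u + β⁻¹ • v)
      - bilin N (α⁻¹ • u - β⁻¹ • v) (α⁻¹ • u - β⁻¹ • v) = 4 * (α⁻¹ * β⁻¹ * bilin N u v) := by
    have hc : bilin N v u = bilin N u v := bilin_comm ((sampleCov_isSymm _).sub hsymm) v u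
    simp only [map_add, map_sub, map_smul, LinearMap.add_apply, LinearMap.sub_apply,
      LinearMap.smul_apply, smul_eq_mul]
    rw [hc]
    ring
  have hb : |4 * (α⁻¹ * β⁻¹ * bilin N u v)| ≤ 32 * devRate n t := by
    rw [← hpol]
    refine (abs_sub _ _).trans ((add_le_add c1 c2).trans ?_)
    have := mul_le_mul_of_nonneg_right hpar (devRate_nonneg (n := n) ht)
    linarith
  rw [abs_mul, abs_mul, abs_of_pos (by norm_num : (0:ℝ) < 4), abs_of_pos (by positivity)] at hb
  have : |bilin N u v| = α * β * (α⁻¹ * β⁻¹ * |bilin N u v|) := by field_simp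
  rw [this] at hω
  have : α * β * (α⁻¹ * β⁻¹ * |bilin N u v|) ≤ α * β * (8 * devRate n t) :=
    mul_le_mul_of_nonneg_left (by linarith) (by positivity)
  linarith

end SampleCov

/-! ### Nets of the Euclidean ball -/

section Net

variable {p : ℕ}

/-- A 1-separated subset of the ball of radius 2 of maximal cardinality is a 1-net; a volume bound
limits its size. -/
lemma exists_separated_net (p : ℕ) : ∃ s : Finset (EuclideanSpace ℝ (Fin p)), s.card ≤ 5 ^ p ∧
    (∀ c ∈ s, ‖c‖ ≤ 2) ∧ ∀ x : EuclideanSpace ℝ (Fin p), ‖x‖ ≤ 2 → ∃ c ∈ s, ‖x - c‖ ≤ 1 := by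
  classical
  let good : Finset (EuclideanSpace ℝ (Fin p)) → Prop := fun s =>
    (∀ c ∈ s, ‖c‖ ≤ 2) ∧ ∀ c ∈ s, ∀ d ∈ s, c ≠ d → 1 ≤ ‖c - d‖
  have hcard : ∀ s, good s → s.card ≤ 5 ^ p := fun s hs => by
    simpa using Besicovitch.card_le_of_separated s hs.1 hs.2
  have hne : {k | ∃ s, good s ∧ s.card = k}.Nonempty := ⟨0, ∅, by simp [good], rfl⟩
  have hbdd : BddAbove {k | ∃ s, good s ∧ s.card = k} := ⟨5 ^ p, by
    rintro _ ⟨s, hs, rfl⟩; exact hcard s hs⟩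
  obtain ⟨s, hs, hmax⟩ := Nat.sSup_mem hne hbdd
  refine ⟨s, hcard s hs, hs.1, fun x hx => ?_⟩
  by_contra! hcon
  have hxs : x ∉ s := fun h => by
    have := hcon x h
    rw [sub_self, norm_zero] at this
    linarith
  have hgood : good (insert x s) := by
    refine ⟨?_, ?_⟩
    · simpa using ⟨hx, hs.1⟩
    · intro c hc d hd hcd
      rcases Finset.mem_insert.1 hc with rfl | hc' <;> rcases Finset.mem_insert.1 hd with rfl | hd'
      · exact absurd rfl hcd
      · exact (hcon d hd').le
      · rw [norm_sub_rev]; exact (hcon c hc').le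
      · exact hs.2 c hc' d hd' hcd
  have := le_csSup hbdd ⟨_, hgood, rfl⟩
  rw [← hmax, Finset.card_insert_of_notMem hxs] at this
  omega

/-- Two-stage approximation: c approximates 2x within 1, then d approximates the rescaled error 2(2x
− c) within 1, so c/2 + d/4 is within 1/4 of x. Its norm is at most 1 + 1/2 and there are at most
5^p · 5^p such points. -/
lemma exists_quarter_net (p : ℕ) : ∃ s : Finset (EuclideanSpace ℝ (Fin p)), s.card ≤ 25 ^ p ∧
    (∀ c ∈ s, ‖c‖ ≤ 3 / 2) ∧
    ∀ x : EuclideanSpace ℝ (Fin p), ‖x‖ ≤ 1 → ∃ c ∈ s, ‖x - c‖ ≤ 1 / 4 := by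
  classical
  obtain ⟨s, hcard, hnorm, hnet⟩ := exists_separated_net p
  refine ⟨Finset.image₂ (fun c d => (1 / 2 : ℝ) • c + (1 / 4 : ℝ) • d) s s, ?_, ?_, ?_⟩
  · calc _ ≤ s.card * s.card := Finset.card_image₂_le _ _ _
      _ ≤ 5 ^ p * 5 ^ p := Nat.mul_le_mul hcard hcard
      _ = 25 ^ p := by rw [← mul_pow]; norm_num
  · intro x hx
    obtain ⟨c, hc, d, hd, rfl⟩ := Finset.mem_image₂.1 hx
    refine (norm_add_le _ _).trans ?_
    rw [norm_smul, norm_smul, Real.norm_of_nonneg (by norm_num), Real.norm_of_nonneg (by norm_num)]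
    have := hnorm c hc; have := hnorm d hd
    linarith
  · intro x hx
    obtain ⟨c, hc, hxc⟩ := hnet ((2 : ℝ) • x) (by
      rw [norm_smul, Real.norm_of_nonneg (by norm_num)]; linarith)
    obtain ⟨d, hd, hxd⟩ := hnet ((2 : ℝ) • ((2 : ℝ) • x - c)) (by
      rw [norm_smul, Real.norm_of_nonneg (by norm_num)]; linarith)
    refine ⟨_, Finset.mem_image₂.2 ⟨c, hc, d, hd, rfl⟩, ?_⟩
    rw [show x - ((1 / 2 : ℝ) • c + (1 / 4 : ℝ) • d)
      = (1 / 4 : ℝ) • ((2 : ℝ) • ((2 : ℝ) • x - c) - d) by module, norm_smul,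
      Real.norm_of_nonneg (by norm_num)]
    linarith

/-- A bilinear form that is small on a net is small on the ball. -/
lemma bilin_self_le_of_net {M : Matrix (Fin p) (Fin p) ℝ} {s : Finset (EuclideanSpace ℝ (Fin p))}
    (hs : ∀ c ∈ s, ‖c‖ ≤ 3 / 2)
    (hnet : ∀ x : EuclideanSpace ℝ (Fin p), ‖x‖ ≤ 1 → ∃ c ∈ s, ‖x - c‖ ≤ 1 / 4) {b : ℝ}
    (hb : ∀ c ∈ s, ∀ d ∈ s, |bilin M c.ofLp d.ofLp| ≤ b) (x : Fin p → ℝ) :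
    bilin M x x ≤ 8 / 3 * b * (x ⬝ᵥ x) := by
  let T := Matrix.toEuclideanCLM (n := Fin p) (𝕜 := ℝ) M
  have hT : ∀ x y : EuclideanSpace ℝ (Fin p), inner ℝ x (T y) = bilin M x.ofLp y.ofLp := by
    intro x y
    rw [bilin, Matrix.toLinearMap₂'_apply', EuclideanSpace.inner_eq_star_dotProduct,
      Matrix.ofLp_toEuclideanCLM, star_trivial, dotProduct_comm]
  have hb0 : 0 ≤ b := by
    obtain ⟨c, hc, -⟩ := hnet 0 (by simp)
    exact (abs_nonneg _).trans (hb c hc c hc)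
  have hL0 : 0 ≤ ‖T‖ := norm_nonneg T
  have hinner : ∀ x y, |inner ℝ x (T y)| ≤ ‖x‖ * (‖T‖ * ‖y‖) := fun x y =>
    (abs_real_inner_le_norm _ _).trans (by gcongr; exact T.le_opNorm y)
  -- Here 5/8 = 1/4 + (3/2)(1/4): the error in x, then the error in y paired with a net point of
  -- norm at most 3/2.
  have hunit : ∀ x y : EuclideanSpace ℝ (Fin p), ‖x‖ ≤ 1 → ‖y‖ ≤ 1 →
      inner ℝ x (T y) ≤ b + 5 / 8 * ‖T‖ := by
    intro x y hx hy
    obtain ⟨c, hc, hxc⟩ := hnet x hx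
    obtain ⟨d, hd, hyd⟩ := hnet y hy
    have e : inner ℝ x (T y) = inner ℝ c (T d) + inner ℝ (x - c) (T y) + inner ℝ c (T (y - d)) := by
      rw [map_sub, inner_sub_left, inner_sub_right]; ring
    have h1 := (le_abs_self _).trans ((congrArg abs (hT c d)).le.trans (hb c hc d hd))
    have h2 := (le_abs_self _).trans (hinner (x - c) y)
    have h3 := (le_abs_self _).trans (hinner c (y - d))
    have h4 : ‖x - c‖ * (‖T‖ * ‖y‖) ≤ 1 / 4 * (‖T‖ * 1) := by gcongr
    have h5 : ‖c‖ * (‖T‖ * ‖y - d‖) ≤ 3 / 2 * (‖T‖ * (1 / 4)) := by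
      have := hs c hc; gcongr
    rw [e]; linarith
  -- Testing against the normalized T y bounds the operator norm by itself; absorbing 5/8 ‖T‖ leaves
  -- ‖T‖ ≤ 8b/3.
  have hop : ‖T‖ ≤ b + 5 / 8 * ‖T‖ := by
    refine ContinuousLinearMap.opNorm_le_of_unit_norm (by positivity) fun y hy => ?_
    rcases (norm_nonneg (T y)).eq_or_lt with h | h
    · rw [← h]; positivity
    · have := hunit ((‖T y‖)⁻¹ • T y) y (by
        rw [norm_smul, norm_inv, norm_norm, inv_mul_cancel₀ h.ne']) hy.le
      rw [real_inner_smul_left, real_inner_self_eq_norm_sq] at this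
      rwa [pow_two, inv_mul_cancel_left₀ h.ne'] at this
  have h := (le_abs_self _).trans (hinner (WithLp.toLp 2 x) (WithLp.toLp 2 x))
  rw [hT] at h
  have hxx : ‖WithLp.toLp 2 x‖ * ‖WithLp.toLp 2 x‖ = x ⬝ᵥ x := by
    rw [← pow_two, EuclideanSpace.norm_sq_eq]
    simp [dotProduct, pow_two]
  calc bilin M x x ≤ ‖T‖ * (‖WithLp.toLp 2 x‖ * ‖WithLp.toLp 2 x‖) := by linarith
    _ ≤ 8 / 3 * b * (‖WithLp.toLp 2 x‖ * ‖WithLp.toLp 2 x‖) := by gcongr; linarith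
    _ = _ := by rw [hxx]

end Net

/-! ### Quadratic forms of the latent and error covariances -/

section Forms

variable {p K : ℕ} {g : Fin p → Fin K}

lemma avg_eq_mulVec (a : Fin p) : avg g a = partnershipMatrix g *ᵥ Pi.single a 1 := by
  funext c
  rw [Matrix.mulVec_single_one]
  exact partnership_symm a c

lemma dev_eq (a : Fin p) :
    dev g a = Pi.single a 1 - partnershipMatrix g *ᵥ Pi.single a 1 := by
  rw [dev, avg_eq_mulVec]

lemma partnership_mulVec_centered (x : Fin p → ℝ) :
    partnershipMatrix g *ᵥ (x - partnershipMatrix g *ᵥ x) = 0 := by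
  rw [Matrix.mulVec_sub, Matrix.mulVec_mulVec, partnership_mul_self, sub_self]

lemma centered_dot_self_le (x : Fin p → ℝ) :
    (x - partnershipMatrix g *ᵥ x) ⬝ᵥ (x - partnershipMatrix g *ᵥ x) ≤ x ⬝ᵥ x := by
  have h : partnershipMatrix g *ᵥ x ⬝ᵥ partnershipMatrix g *ᵥ x = x ⬝ᵥ partnershipMatrix g *ᵥ x := by
    rw [Matrix.dotProduct_mulVec, ← Matrix.mulVec_transpose, partnership_isSymm.eq,
      Matrix.mulVec_mulVec, partnership_mul_self, dotProduct_comm]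
  have h0 : 0 ≤ partnershipMatrix g *ᵥ x ⬝ᵥ partnershipMatrix g *ᵥ x :=
    Finset.sum_nonneg fun _ _ => mul_self_nonneg _
  rw [sub_dotProduct, dotProduct_sub, dotProduct_sub, h, dotProduct_comm (partnershipMatrix g *ᵥ x) x]
  linarith

lemma dev_dot_self_le (b : Fin p) : dev g b ⬝ᵥ dev g b ≤ 1 := by
  rw [dev_eq]
  refine (centered_dot_self_le _).trans ?_
  simp

lemma submatrix_mul_partnership (C : Matrix (Fin K) (Fin K) ℝ) :
    C.submatrix g g * partnershipMatrix g = C.submatrix g g := by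
  ext a b
  rw [Matrix.mul_apply]
  have : ∀ c, C.submatrix g g a c * partnershipMatrix g c b
      = C.submatrix g g a b * partnershipMatrix g c b := fun c => by
    by_cases h : g c = g b
    · simp [h]
    · simp [partnershipMatrix, h]
  simp_rw [this, ← Finset.mul_sum, partnership_col_sum, mul_one]

/-- The lifted matrix is constant on blocks, so it only sees group averages: the latent signal is
invisible on centered vectors. -/
lemma bilin_submatrix_eq_zero (C : Matrix (Fin K) (Fin K) ℝ) (u : Fin p → ℝ) {x : Fin p → ℝ}
    (hx : partnershipMatrix g *ᵥ x = 0) : bilin (C.submatrix g g) u x = 0 := by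
  rw [bilin, Matrix.toLinearMap₂'_apply', ← submatrix_mul_partnership, ← Matrix.mulVec_mulVec, hx,
    Matrix.mulVec_zero, dotProduct_zero]

lemma bilin_submatrix_avg {C : Matrix (Fin K) (Fin K) ℝ} (hC : C.IsSymm) (a b : Fin p) :
    bilin (C.submatrix g g) (avg g a) (avg g b) = C (g a) (g b) := by
  have hS : (C.submatrix g g).IsSymm := hC.submatrix g
  have h : ∀ u, ∀ b, bilin (C.submatrix g g) u (avg g b)
      = bilin (C.submatrix g g) u (Pi.single b 1) := fun u b => by
    rw [single_eq (g := g) b, map_add, bilin_submatrix_eq_zero C u (partnership_mulVec_dev b),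
      add_zero]
  rw [h, bilin_comm hS, h]
  simp [bilin, Matrix.toLinearMap₂'_apply', hC.apply]

lemma bilin_submatrix_avg_sub {C : Matrix (Fin K) (Fin K) ℝ} (hC : C.IsSymm) (a b : Fin p) :
    bilin (C.submatrix g g) (avg g a - avg g b) (avg g a - avg g b)
      = C (g a) (g a) + C (g b) (g b) - 2 * C (g a) (g b) := by
  simp only [map_sub, LinearMap.sub_apply, bilin_submatrix_avg hC, hC.apply (g a) (g b)]
  ring

lemma bilin_of_isDiag {D : Matrix (Fin p) (Fin p) ℝ} (hD : D.IsDiag) (u v : Fin p → ℝ) :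
    bilin D u v = ∑ c, D c c * (u c * v c) := by
  rw [bilin, Matrix.toLinearMap₂'_apply', dotProduct]
  refine Finset.sum_congr rfl fun c _ => ?_
  rw [Matrix.mulVec, dotProduct, Finset.sum_eq_single c
    (fun b _ hb => by rw [hD hb.symm, zero_mul]) (by simp)]
  ring

lemma bilin_self_le_of_isDiag {D : Matrix (Fin p) (Fin p) ℝ} (hD : D.IsDiag) {γ : ℝ}
    (h : ∀ c, D c c ≤ γ) (u : Fin p → ℝ) : bilin D u u ≤ γ * (u ⬝ᵥ u) := by
  rw [bilin_of_isDiag hD, dotProduct, Finset.mul_sum]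
  exact Finset.sum_le_sum fun c _ => mul_le_mul_of_nonneg_right (h c) (mul_self_nonneg _)

lemma bilin_self_nonneg_of_isDiag {D : Matrix (Fin p) (Fin p) ℝ} (hD : D.IsDiag)
    (h : ∀ c, 0 ≤ D c c) (u : Fin p → ℝ) : 0 ≤ bilin D u u := by
  rw [bilin_of_isDiag hD]
  exact Finset.sum_nonneg fun c _ => mul_nonneg (h c) (mul_self_nonneg _)

/-- For different groups, avg_a and dev_b have disjoint supports. What remains is a difference of
two numbers in [0, δ/m], one from avg_b and one from the entry at b. -/
lemma abs_bilin_avg_sub_dev_le_of_isDiag {D : Matrix (Fin p) (Fin p) ℝ} (hD : D.IsDiag) {δ m : ℝ}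
    (hm : 0 < m) (hmin : ∀ k, m ≤ (group g k).card) (h0 : ∀ c, 0 ≤ D c c) (h1 : ∀ c, D c c ≤ δ)
    {a b : Fin p} (hab : g a ≠ g b) : |bilin D (avg g a - avg g b) (dev g b)| ≤ δ / m := by
  have hδ : 0 ≤ δ := (h0 a).trans (h1 a)
  have hterm : ∀ c, (avg g a - avg g b) c * dev g b c
      = avg g b c * avg g b c - avg g b c * (Pi.single b 1 : Fin p → ℝ) c := fun c => by
    have hz : avg g a c * dev g b c = 0 := by
      by_cases hac : g a = g c
      · have hcb : c ≠ b := fun h => hab (h ▸ hac)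
        have : g b ≠ g c := fun h => hab (hac.trans h.symm)
        simp [dev, avg, partnershipMatrix, this, hcb]
      · simp [avg, partnershipMatrix, hac]
    rw [Pi.sub_apply, sub_mul, hz, dev, Pi.sub_apply]; ring
  have hP : avg g b ⬝ᵥ avg g b ≤ 1 / m := by
    rw [avg_dot_avg]
    simp only [partnershipMatrix, Matrix.of_apply, if_true]
    exact one_div_le_one_div_of_le hm (hmin _)
  have hPb : avg g b b ≤ 1 / m := by
    have h := hP
    rw [avg_dot_avg] at h
    exact h
  have hPb0 : 0 ≤ avg g b b := partnership_nonneg b b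
  have e : bilin D (avg g a - avg g b) (dev g b)
      = bilin D (avg g b) (avg g b) - D b b * avg g b b := by
    rw [bilin_of_isDiag hD, bilin_of_isDiag hD]
    simp_rw [hterm, mul_sub, Finset.sum_sub_distrib]
    simp [Pi.single_apply]
  have u1 := bilin_self_nonneg_of_isDiag hD h0 (avg g b)
  have u2 := (bilin_self_le_of_isDiag hD h1 (avg g b)).trans (mul_le_mul_of_nonneg_left hP hδ)
  have u3 : D b b * avg g b b ≤ δ * (1 / m) := mul_le_mul (h1 b) hPb hPb0 hδ
  have u4 := mul_nonneg (h0 b) hPb0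
  rw [e, abs_le, div_eq_mul_one_div δ m]
  constructor <;> linarith

end Forms

/-! ### The covariance of the observations -/

section Latent

variable {p K : ℕ} {g : Fin p → Fin K} {Ω₀ : Type*} [MeasurableSpace Ω₀] {P₀ : Measure Ω₀}
  {X : Ω₀ → Fin p → ℝ} {Z : Ω₀ → Fin K → ℝ} {E : Ω₀ → Fin p → ℝ}

lemma LatentDecomposition.isDiag_covMatrix_E (h : LatentDecomposition P₀ g X Z E) :
    (covMatrix P₀ E).IsDiag := fun a b hab =>
  (h.indep_E.indepFun hab).covariance_eq_zero (h.memLp_E a) (h.memLp_E b)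

variable [IsProbabilityMeasure P₀]

lemma LatentDecomposition.mean_X (h : LatentDecomposition P₀ g X Z E) (a : Fin p) :
    ∫ ω, X ω a ∂P₀ = 0 := by
  simp only [h.decomp]
  rw [integral_add ((h.memLp_Z _).integrable one_le_two) ((h.memLp_E _).integrable one_le_two),
    h.mean_Z, h.mean_E, add_zero]

lemma LatentDecomposition.covMatrix_X (h : LatentDecomposition P₀ g X Z E) :
    covMatrix P₀ X = (covMatrix P₀ Z).submatrix g g + covMatrix P₀ E := by
  have hZE : ∀ k a, cov[fun ω => Z ω k, fun ω => E ω a; P₀] = 0 := fun k a =>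
    (h.indep_Z_E.comp (measurable_pi_apply k) (measurable_pi_apply a)).covariance_eq_zero
      (h.memLp_Z k) (h.memLp_E a)
  have hEZ : ∀ k a, cov[fun ω => E ω a, fun ω => Z ω k; P₀] = 0 := fun k a => by
    rw [covariance_comm, hZE]
  ext a b
  have hX : ∀ a, (fun ω => X ω a) = (fun ω => Z ω (g a)) + fun ω => E ω a := fun a => by
    funext ω; exact h.decomp ω a
  simp only [covMatrix, Matrix.of_apply, Matrix.add_apply, Matrix.submatrix_apply]
  rw [hX a, hX b, covariance_add_left (h.memLp_Z _) (h.memLp_E _)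
      ((h.memLp_Z _).add (h.memLp_E _)),
    covariance_add_right (h.memLp_Z _) (h.memLp_Z _) (h.memLp_E _),
    covariance_add_right (h.memLp_E _) (h.memLp_Z _) (h.memLp_E _), hZE, hEZ]
  ring

lemma abs_apply_le_entrySupNorm (M : Matrix (Fin p) (Fin p) ℝ) (a b : Fin p) :
    |M a b| ≤ entrySupNorm M :=
  (le_ciSup (f := fun b => |M a b|) (Set.finite_range _).bddAbove b).trans
    (le_ciSup (f := fun a => ⨆ b, |M a b|) (Set.finite_range _).bddAbove a)

/-- The shift is the largest diagonal entry. Making the shifted error nonnegative lets it only help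
the separation term. -/
lemma exists_shift_of_variationSeminorm_le {D : Matrix (Fin p) (Fin p) ℝ} {δ : ℝ}
    (h : variationSeminorm D ≤ δ) : ∃ c, ∀ a, 0 ≤ c - D a a ∧ c - D a a ≤ δ := by
  refine ⟨⨆ a, D a a, fun a => ⟨sub_nonneg.2 (le_ciSup (f := fun a => D a a)
    (Set.finite_range _).bddAbove a), le_trans ?_ h⟩⟩
  exact sub_le_sub_left (ciInf_le (f := fun a => D a a) (Set.finite_range _).bddBelow a) _

end Latent

/-! ### Exact recovery -/

section Recovery

/-- Here l stands for log p. The right side keeps 3Δ/8 minus error terms. After moving all errors to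
one side, the largest coefficient is 9216, and 9216/40000 < 3/8. -/
lemma separation_arith {γ δ Δ m n p l : ℝ} (hγ : 0 ≤ γ) (hδ : 0 ≤ δ) (hΔ : 0 < Δ) (hm : 1 ≤ m)
    (hn : 0 < n) (hp : 0 ≤ p) (hl : 0 ≤ l) (h1 : l ≤ 1 / 40000 * n)
    (h2 : 40000 * (γ * (√(l / (m * n)) + √(p / (n * m ^ 2)) + l / n + p / (n * m)) + δ / m) ≤ Δ) :
    (48 * γ * (√(8 * p / n) + 8 * p / n) + δ) / m
      < (Δ - 8 * (Δ + 2 * γ / m) * (√(3 * l / n) + 3 * l / n)) / 2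
        - 2 * (8 * (√(Δ + 2 * γ / m) * √γ) * (√(3 * l / n) + 3 * l / n) + δ / m) := by
  have hm0 : 0 < m := by linarith
  set s := √(l / n) with hs
  have hs0 : 0 ≤ s := Real.sqrt_nonneg _
  have hss : s ^ 2 = l / n := Real.sq_sqrt (by positivity)
  -- 1/200 = √(1/40000); this makes the linear part of the deviation rate negligible against its
  -- square root.
  have hs1 : s ≤ 1 / 200 := by
    rw [hs, Real.sqrt_le_left (by norm_num), div_le_iff₀ hn]; linarith
  set w := √m with hw
  have hw0 : 0 < w := Real.sqrt_pos.2 hm0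
  have hww : w ^ 2 = m := Real.sq_sqrt hm0.le
  have hw1 : 1 ≤ w := by rw [hw]; exact Real.one_le_sqrt.2 hm
  have t1 : √(l / (m * n)) = s / w := by
    rw [mul_comm, ← div_div, Real.sqrt_div (by positivity)]
  set q := √(p / n) with hq
  have hq0 : 0 ≤ q := Real.sqrt_nonneg _
  have t2 : √(p / (n * m ^ 2)) = q / m := by
    rw [← div_div, Real.sqrt_div (by positivity), Real.sqrt_sq hm0.le]
  have t3 : √(8 * p / n) ≤ 3 * q := by
    rw [mul_div_assoc, Real.sqrt_mul (by norm_num)]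
    gcongr
    rw [Real.sqrt_le_left (by norm_num)]; norm_num
  have t4 : √(3 * l / n) + 3 * l / n ≤ 3 * s := by
    have : √(3 * l / n) ≤ 2 * s := by
      rw [mul_div_assoc, Real.sqrt_mul (by norm_num)]
      gcongr
      rw [Real.sqrt_le_left (by norm_num)]; norm_num
    have : 3 * l / n = 3 * s ^ 2 := by rw [hss]; ring
    nlinarith
  set ρ := √(3 * l / n) + 3 * l / n with hρ
  have hρ0 : 0 ≤ ρ := by positivity
  have hA : √(Δ + 2 * γ / m) * √γ ≤ √Δ * √γ + 3 / 2 * γ / w := by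
    have e1 : √(Δ + 2 * γ / m) ≤ √Δ + √(2 * γ / m) := by
      rw [Real.sqrt_le_left (by positivity), add_sq, Real.sq_sqrt hΔ.le, Real.sq_sqrt (by positivity)]
      have : 0 ≤ 2 * √Δ * √(2 * γ / m) := by positivity
      linarith
    have e2 : √(2 * γ / m) * √γ ≤ 3 / 2 * γ / w := by
      rw [← Real.sqrt_mul (by positivity), Real.sqrt_le_left (by positivity), div_pow, hww]
      rw [div_mul_eq_mul_div]
      gcongr
      nlinarith [sq_nonneg γ]
    calc _ ≤ (√Δ + √(2 * γ / m)) * √γ := by gcongr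
      _ ≤ _ := by rw [add_mul]; linarith
  -- AM-GM splits the cross term, so that √(Δ γ log p / n) costs a fraction of Δ plus a multiple of
  -- γ log p / n.
  have hAM : 48 * (√Δ * √γ) * s ≤ Δ / 16 + 9216 * (γ * (l / n)) := by
    have := sq_nonneg (√Δ / 4 - 96 * (√γ * s))
    have e1 := Real.sq_sqrt hΔ.le
    have e2 := Real.sq_sqrt hγ
    have e3 : (√γ * s) ^ 2 = γ * (l / n) := by rw [mul_pow, e2, hss]
    nlinarith
  have b1 : 8 * (Δ + 2 * γ / m) * ρ ≤ Δ / 8 + 48 * (γ * (s / w)) := by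
    have f1 : 8 * (Δ + 2 * γ / m) * ρ ≤ 8 * (Δ + 2 * γ / m) * (3 * s) := by gcongr
    have f2 : γ / m * s ≤ γ * (s / w) := by
      rw [div_mul_eq_mul_div, ← mul_div_assoc]
      gcongr
      rw [← hww]; nlinarith
    have f3 : Δ * s ≤ Δ * (1 / 200) := by gcongr
    calc _ ≤ _ := f1
      _ = 24 * (Δ * s) + 48 * (γ / m * s) := by ring
      _ ≤ _ := by linarith
  have b2 : 16 * (√(Δ + 2 * γ / m) * √γ) * ρ
      ≤ Δ / 16 + 9216 * (γ * (l / n)) + 72 * (γ * (s / w)) := by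
    calc _ ≤ 16 * (√Δ * √γ + 3 / 2 * γ / w) * (3 * s) := by gcongr
      _ = 48 * (√Δ * √γ) * s + 72 * (γ * (s / w)) := by ring
      _ ≤ _ := by linarith
  have b3 : (48 * γ * (√(8 * p / n) + 8 * p / n) + δ) / m
      ≤ 144 * (γ * (q / m)) + 384 * (γ * (p / (n * m))) + δ / m := by
    calc _ ≤ (48 * γ * (3 * q + 8 * p / n) + δ) / m := by gcongr
      _ = _ := by field_simp; ring
  rw [t1, t2] at h2
  have n1 : 0 ≤ γ * (s / w) := by positivity
  have n2 : 0 ≤ γ * (q / m) := by positivity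
  have n3 : 0 ≤ γ * (l / n) := by positivity
  have n4 : 0 ≤ γ * (p / (n * m)) := by positivity
  have n5 : 0 ≤ δ / m := by positivity
  linarith

variable {p K : ℕ} {g : Fin p → Fin K}

/-- Exact recovery when the noise matrix `N` is small on the relevant vectors. -/
theorem sdpArgmax_eq_of_small_noise {C : Matrix (Fin K) (Fin K) ℝ} (hC : C.IsSymm)
    {N D : Matrix (Fin p) (Fin p) ℝ} (hN : N.IsSymm) (hD : D.IsDiag) {m δ κ : ℝ}
    (hm : 0 < m) (hmin : ∀ k, m ≤ (group g k).card) (hδ : 0 ≤ δ) (hκ : 0 ≤ κ)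
    (h0 : ∀ c, 0 ≤ D c c) (h1 : ∀ c, D c c ≤ δ)
    (hquad : ∀ x, partnershipMatrix g *ᵥ x = 0 → bilin N x x ≤ κ * (x ⬝ᵥ x))
    (hsep : ∀ a b, g a ≠ g b → (κ + δ) / m
      < ((C (g a) (g a) + C (g b) (g b) - 2 * C (g a) (g b))
          - |bilin N (avg g a - avg g b) (avg g a - avg g b)|) / 2
        - 2 * (|bilin N (avg g a - avg g b) (dev g b)| + δ / m)) :
    sdpArgmax K (N + C.submatrix g g + D) = {partnershipMatrix g} := by
  have hDs : D.IsSymm := hD.isSymm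
  refine sdpArgmax_eq_of_separated ((hN.add (hC.submatrix g)).add hDs) hm hmin (add_nonneg hκ hδ)
    (fun x hx => ?_) fun a b hab => ?_
  · simp only [map_add, LinearMap.add_apply, bilin_submatrix_eq_zero C x hx]
    have := hquad x hx
    have := bilin_self_le_of_isDiag hD h1 x
    linarith
  · have e1 := bilin_submatrix_avg_sub (g := g) hC a b
    have e2 := bilin_submatrix_eq_zero C (avg g a - avg g b) (partnership_mulVec_dev (g := g) b)
    have e3 := bilin_self_nonneg_of_isDiag hD h0 (avg g a - avg g b)
    have e4 := (abs_le.1 (abs_bilin_avg_sub_dev_le_of_isDiag hD hm hmin h0 h1 hab)).2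
    have e5 := neg_abs_le (bilin N (avg g a - avg g b) (avg g a - avg g b))
    have e6 := le_abs_self (bilin N (avg g a - avg g b) (dev g b))
    have := hsep a b hab
    simp only [bilin, map_add, LinearMap.add_apply] at *
    rw [e1, e2]
    linarith

end Recovery

/-! ### Uniform control of the noise by union bounds -/

section UnionBound

variable {p K n : ℕ} {g : Fin p → Fin K}

/-- Conjugating by the centering projection moves the constraint on the vectors into the matrix, so
a net of the full ball can be used. -/
lemma bilin_centered (N : Matrix (Fin p) (Fin p) ℝ) (u v : Fin p → ℝ) :
    bilin ((1 - partnershipMatrix g)ᵀ * N * (1 - partnershipMatrix g)) u v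
      = bilin N (u - partnershipMatrix g *ᵥ u) (v - partnershipMatrix g *ᵥ v) := by
  have h : ∀ x : Fin p → ℝ, x - partnershipMatrix g *ᵥ x = (1 - partnershipMatrix g) *ᵥ x :=
    fun x => by rw [Matrix.sub_mulVec, Matrix.one_mulVec]
  rw [h, h, bilin, bilin, Matrix.toLinearMap₂'_apply', Matrix.toLinearMap₂'_apply',
    ← Matrix.mulVec_mulVec, ← Matrix.mulVec_mulVec, Matrix.dotProduct_mulVec, Matrix.vecMul_transpose]

lemma bilin_self_le_of_centered_net {N : Matrix (Fin p) (Fin p) ℝ}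
    {s : Finset (EuclideanSpace ℝ (Fin p))} (hs : ∀ c ∈ s, ‖c‖ ≤ 3 / 2)
    (hnet : ∀ x : EuclideanSpace ℝ (Fin p), ‖x‖ ≤ 1 → ∃ c ∈ s, ‖x - c‖ ≤ 1 / 4) {b : ℝ}
    (hb : ∀ c ∈ s, ∀ d ∈ s, |bilin N (c.ofLp - partnershipMatrix g *ᵥ c.ofLp)
      (d.ofLp - partnershipMatrix g *ᵥ d.ofLp)| ≤ b) {x : Fin p → ℝ}
    (hx : partnershipMatrix g *ᵥ x = 0) : bilin N x x ≤ 8 / 3 * b * (x ⬝ᵥ x) := by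
  have h := bilin_self_le_of_net (M := (1 - partnershipMatrix g)ᵀ * N * (1 - partnershipMatrix g))
    hs hnet (fun c hc d hd => by rw [bilin_centered]; exact hb c hc d hd) x
  rwa [bilin_centered, hx, sub_zero] at h

lemma exp_neg_three_log {p : ℕ} (hp : 0 < p) : Real.exp (-(3 * Real.log p)) = ((p : ℝ) ^ 3)⁻¹ := by
  have : (0 : ℝ) < p := by exact_mod_cast hp
  rw [Real.exp_neg, mul_comm, Real.exp_mul, Real.exp_log this]
  norm_cast

lemma net_card_mul_exp_le {p : ℕ} (hp : 0 < p) :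
    (25 : ℝ) ^ p * 25 ^ p * Real.exp (-(8 * p)) ≤ 1 / p := by
  have hp' : (0 : ℝ) < p := by exact_mod_cast hp
  -- Of the exponent 8p, the part 7p pays for the pairs of net points and the remaining factor
  -- exp(−p) is below 1/p.
  have h7 : (25 : ℝ) * 25 ≤ Real.exp 7 := by
    have h1 : (2.7 : ℝ) ≤ Real.exp 1 := by linarith [Real.exp_one_gt_d9]
    calc (25 : ℝ) * 25 ≤ 2.7 ^ 7 := by norm_num
      _ ≤ Real.exp 1 ^ 7 := by gcongr
      _ = Real.exp 7 := by rw [← Real.exp_nat_mul]; norm_num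
  calc (25 : ℝ) ^ p * 25 ^ p * Real.exp (-(8 * p)) ≤ Real.exp 7 ^ p * Real.exp (-(8 * p)) := by
        rw [← mul_pow]; gcongr
    _ = Real.exp (-p) := by rw [← Real.exp_nat_mul, ← Real.exp_add]; congr 1; ring
    _ ≤ 1 / p := by
        rw [Real.exp_neg, one_div]
        exact inv_anti₀ hp' (by linarith [Real.add_one_le_exp (p : ℝ)])

lemma measureReal_biUnion_le_card_mul {ι Ω : Type*} [MeasurableSpace Ω] {P : Measure Ω} (s : Finset ι)
    (f : ι → Set Ω) {c : ℝ} (h : ∀ i ∈ s, P.real (f i) ≤ c) :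
    P.real (⋃ i ∈ s, f i) ≤ s.card * c := by
  refine (measureReal_biUnion_finset_le s f).trans ((Finset.sum_le_sum h).trans ?_)
  rw [Finset.sum_const, nsmul_eq_mul]

variable {Ω₀ : Type*} [MeasurableSpace Ω₀] {P₀ : Measure Ω₀} [IsProbabilityMeasure P₀]
  {X : Ω₀ → Fin p → ℝ} {Ω : Type*} [MeasurableSpace Ω] {P : Measure Ω} [IsProbabilityMeasure P]
  {Xobs : Fin n → Ω → Fin p → ℝ}

/-- With high probability, the noise matrix is simultaneously small on all the vectors that matter
for exact recovery. -/
theorem exists_measure_bad_le (hp : 0 < p) (hn : 0 < n) (hX : HasGaussianLaw X P₀)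
    (hmean : ∀ a, ∫ ω, X ω a ∂P₀ = 0) (hind : iIndepFun Xobs P)
    (hY : ∀ i, IdentDistrib (Xobs i) X P P₀) {γ : ℝ} (hγ : 0 ≤ γ) {A : Fin p → Fin p → ℝ}
    (hA : ∀ a b, 0 ≤ A a b)
    (hvar : ∀ a b, bilin (covMatrix P₀ X) (avg g a - avg g b) (avg g a - avg g b) ≤ A a b)
    (hcen : ∀ x, partnershipMatrix g *ᵥ x = 0 → bilin (covMatrix P₀ X) x x ≤ γ * (x ⬝ᵥ x)) :
    ∃ bad : Set Ω, P.real bad ≤ 12 / p ∧ ∀ ω ∉ bad,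
      (∀ a b, |bilin (sampleCov (fun i => Xobs i ω) - covMatrix P₀ X) (avg g a - avg g b)
          (avg g a - avg g b)| ≤ 8 * A a b * devRate n (3 * Real.log p)) ∧
      (∀ a b, |bilin (sampleCov (fun i => Xobs i ω) - covMatrix P₀ X) (avg g a - avg g b) (dev g b)|
          ≤ 8 * (√(A a b) * √γ) * devRate n (3 * Real.log p)) ∧
      ∀ x, partnershipMatrix g *ᵥ x = 0 →
        bilin (sampleCov (fun i => Xobs i ω) - covMatrix P₀ X) x x
          ≤ 48 * γ * devRate n (8 * p) * (x ⬝ᵥ x) := by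
  have hp' : (0 : ℝ) < p := by exact_mod_cast hp
  have ht : 0 ≤ 3 * Real.log p := by
    have := Real.log_nonneg (Nat.one_le_cast.2 hp : (1 : ℝ) ≤ p); positivity
  have hsq : ∀ a b, A a b = √(A a b) ^ 2 := fun a b => (Real.sq_sqrt (hA a b)).symm
  have hγ2 : γ = √γ ^ 2 := (Real.sq_sqrt hγ).symm
  obtain ⟨s, hcard, hs, hnet⟩ := exists_quarter_net p
  let N : Ω → Matrix (Fin p) (Fin p) ℝ := fun ω => sampleCov (fun i => Xobs i ω) - covMatrix P₀ X
  let B₁ : Fin p × Fin p → Set Ω := fun q =>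
    {ω | 8 * (√(A q.1 q.2) * √(A q.1 q.2)) * devRate n (3 * Real.log p)
      < |bilin (N ω) (avg g q.1 - avg g q.2) (avg g q.1 - avg g q.2)|}
  let B₂ : Fin p × Fin p → Set Ω := fun q =>
    {ω | 8 * (√(A q.1 q.2) * √γ) * devRate n (3 * Real.log p)
      < |bilin (N ω) (avg g q.1 - avg g q.2) (dev g q.2)|}
  let B₃ : EuclideanSpace ℝ (Fin p) × EuclideanSpace ℝ (Fin p) → Set Ω := fun q =>
    {ω | 8 * (3 / 2 * √γ * (3 / 2 * √γ)) * devRate n (8 * p)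
      < |bilin (N ω) (q.1.ofLp - partnershipMatrix g *ᵥ q.1.ofLp)
        (q.2.ofLp - partnershipMatrix g *ᵥ q.2.ofLp)|}
  have hdev : ∀ b, bilin (covMatrix P₀ X) (dev g b) (dev g b) ≤ √γ ^ 2 := fun b => by
    rw [← hγ2]
    exact (hcen _ (partnership_mulVec_dev b)).trans (mul_le_of_le_one_right hγ (dev_dot_self_le b))
  -- Centering is a contraction, so a net point of norm at most 3/2 keeps variance at most (3/2)² γ.
  have hball : ∀ c : EuclideanSpace ℝ (Fin p), ‖c‖ ≤ 3 / 2 →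
      bilin (covMatrix P₀ X) (c.ofLp - partnershipMatrix g *ᵥ c.ofLp)
        (c.ofLp - partnershipMatrix g *ᵥ c.ofLp) ≤ (3 / 2 * √γ) ^ 2 := fun c hc => by
    have h1 : c.ofLp ⬝ᵥ c.ofLp = ‖c‖ ^ 2 := by
      rw [EuclideanSpace.norm_sq_eq]; simp [dotProduct, pow_two]
    have h2 : ‖c‖ ^ 2 ≤ (3 / 2) ^ 2 := by gcongr
    refine (hcen _ (partnership_mulVec_centered _)).trans ?_
    rw [mul_pow, ← hγ2, mul_comm]
    exact mul_le_mul_of_nonneg_right ((centered_dot_self_le _).trans (h1.le.trans h2)) hγ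
  have hB₁ : ∀ q, P.real (B₁ q) ≤ 4 * Real.exp (-(3 * Real.log p)) := fun q =>
    measure_abs_bilin hn hX hmean hind hY ht (Real.sqrt_nonneg _) (Real.sqrt_nonneg _)
      ((hvar _ _).trans (hsq _ _).le) ((hvar _ _).trans (hsq _ _).le)
  have hB₂ : ∀ q, P.real (B₂ q) ≤ 4 * Real.exp (-(3 * Real.log p)) := fun q =>
    measure_abs_bilin hn hX hmean hind hY ht (Real.sqrt_nonneg _) (Real.sqrt_nonneg _)
      ((hvar _ _).trans (hsq _ _).le) (hdev _)
  have hB₃ : ∀ q ∈ s ×ˢ s, P.real (B₃ q) ≤ 4 * Real.exp (-(8 * p)) := fun q hq =>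
    measure_abs_bilin hn hX hmean hind hY (by positivity) (by positivity) (by positivity)
      (hball _ (hs _ (Finset.mem_product.1 hq).1)) (hball _ (hs _ (Finset.mem_product.1 hq).2))
  refine ⟨(⋃ q ∈ Finset.univ, B₁ q) ∪ (⋃ q ∈ Finset.univ, B₂ q) ∪ ⋃ q ∈ s ×ˢ s, B₃ q, ?_, ?_⟩
  · have m₁ := measureReal_biUnion_le_card_mul Finset.univ B₁ fun q _ => hB₁ q
    have m₂ := measureReal_biUnion_le_card_mul Finset.univ B₂ fun q _ => hB₂ q
    have m₃ := measureReal_biUnion_le_card_mul (s ×ˢ s) B₃ hB₃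
    -- There are p² pairs, each failing with probability at most 4 p⁻³; this is what the level 3 log
    -- p buys.
    have e₁ : ((Finset.univ : Finset (Fin p × Fin p)).card : ℝ)
        * (4 * Real.exp (-(3 * Real.log p))) = 4 / p := by
      rw [exp_neg_three_log hp, Finset.card_univ, Fintype.card_prod, Fintype.card_fin]
      rw [Nat.cast_mul]
      field_simp
    have e₃ : ((s ×ˢ s).card : ℝ) * (4 * Real.exp (-(8 * p))) ≤ 4 / p := by
      have hc : (s.card : ℝ) ≤ 25 ^ p := by exact_mod_cast hcard
      rw [Finset.card_product]
      push_cast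
      calc (s.card : ℝ) * s.card * (4 * Real.exp (-(8 * p)))
          ≤ 25 ^ p * 25 ^ p * (4 * Real.exp (-(8 * p))) :=
            mul_le_mul_of_nonneg_right (mul_le_mul hc hc (Nat.cast_nonneg _)
              (pow_nonneg (by norm_num) _)) (mul_nonneg (by norm_num) (Real.exp_pos _).le)
        _ = 4 * (25 ^ p * 25 ^ p * Real.exp (-(8 * p))) := by ring
        _ ≤ 4 * (1 / p) := by gcongr; exact net_card_mul_exp_le hp
        _ = 4 / p := by ring
    have u₁ := measureReal_union_le (μ := P)
      ((⋃ q ∈ Finset.univ, B₁ q) ∪ (⋃ q ∈ Finset.univ, B₂ q)) (⋃ q ∈ s ×ˢ s, B₃ q)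
    have u₂ := measureReal_union_le (μ := P) (⋃ q ∈ Finset.univ, B₁ q) (⋃ q ∈ Finset.univ, B₂ q)
    have : (12 : ℝ) / p = 4 / p + 4 / p + 4 / p := by ring
    linarith
  · intro ω hω
    simp only [Set.mem_union, Set.mem_iUnion, not_or, not_exists, Finset.mem_univ, forall_true_left] at hω
    obtain ⟨⟨h₁, h₂⟩, h₃⟩ := hω
    refine ⟨fun a b => ?_, fun a b => not_lt.1 (h₂ (a, b)), fun x hx => ?_⟩
    · have h : |bilin (N ω) (avg g a - avg g b) (avg g a - avg g b)|
          ≤ 8 * (√(A a b) * √(A a b)) * devRate n (3 * Real.log p) := not_lt.1 (h₁ (a, b))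
      rwa [Real.mul_self_sqrt (hA a b)] at h
    -- The constant is 48 = (8/3) · 8 · (3/2)².
    · refine (bilin_self_le_of_centered_net hs hnet (fun c hc d hd =>
        not_lt.1 (h₃ (c, d) (Finset.mk_mem_product hc hd))) hx).trans_eq ?_
      have := Real.mul_self_sqrt hγ
      linear_combination (48 * devRate n (8 * p) * (x ⬝ᵥ x)) * this

end UnionBound

/-! ### Elementary consequences of the separation and of the minimal group size -/

section Separation

variable {p K : ℕ} {g : Fin p → Fin K}

lemma le_of_le_separation {C : Matrix (Fin K) (Fin K) ℝ} (hC : C.IsSymm) {x : EReal}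
    (h : x ≤ separation C) {j k : Fin K} (hjk : j ≠ k) :
    x ≤ ((C j j + C k k - 2 * C j k : ℝ) : EReal) := by
  have key : ∀ j k : Fin K, j < k → x ≤ ((C j j + C k k - 2 * C j k : ℝ) : EReal) :=
    fun j k hlt => h.trans (iInf_le_of_le j (iInf_le_of_le k (iInf_le _ hlt)))
  rcases hjk.lt_or_gt with hlt | hlt
  · exact key j k hlt
  · have := key k j hlt
    rwa [hC.apply j k, add_comm (C k k)] at this

lemma pos_of_pos_separation {C : Matrix (Fin K) (Fin K) ℝ} (hC : C.IsSymm)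
    (h : 0 < separation C) {j k : Fin K} (hjk : j ≠ k) : 0 < C j j + C k k - 2 * C j k := by
  have := h.trans_le (le_of_le_separation hC le_rfl hjk)
  exact_mod_cast this

lemma minGroupSize_le (g : Fin p → Fin K) (k : Fin K) : minGroupSize g ≤ (group g k).card :=
  ciInf_le (OrderBot.bddBelow _) k

lemma one_lt_of_one_lt_minGroupSize (h : 1 < minGroupSize g) : 1 < p := by
  rcases isEmpty_or_nonempty (Fin K) with hK | ⟨⟨k⟩⟩
  -- With no group the infimum takes the default value 0, which is excluded.
  · simp [minGroupSize] at h
  · exact (h.trans_le (minGroupSize_le g k)).trans_le ((Finset.card_le_univ _).trans_eq (by simp))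

end Separation

end Pecok

/-! ### The recovery theorem -/

open Pecok in
theorem mainTheorem1 :
    ∃ c₁ c₂ c₃ : ℝ, 0 < c₁ ∧ 0 < c₂ ∧ 0 < c₃ ∧
      ∀ (n p K : ℕ) (g : Fin p → Fin K)
        -- the vector `X`, Gaussian with a latent decomposition
        (Ω₀ : Type*) [MeasurableSpace Ω₀] (P₀ : Measure Ω₀) [IsProbabilityMeasure P₀]
        (X : Ω₀ → Fin p → ℝ) (Z : Ω₀ → Fin K → ℝ) (E : Ω₀ → Fin p → ℝ)
        (_ : Pecok.LatentDecomposition P₀ g X Z E) (_ : HasGaussianLaw X P₀)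
        (_ : 1 < Pecok.minGroupSize g)
        (_ : 0 < Pecok.separation (Pecok.covMatrix P₀ Z))
        -- the observations: independent copies of `X`
        (Ω : Type*) [MeasurableSpace Ω] (P : Measure Ω) [IsProbabilityMeasure P]
        (Xobs : Fin n → Ω → Fin p → ℝ)
        (_ : iIndepFun Xobs P) (_ : ∀ i, IdentDistrib (Xobs i) X P P₀)
        -- the estimator of the error covariance matrix: a random diagonal matrix
        (Γhat : Ω → Matrix (Fin p) (Fin p) ℝ)
        (_ : ∀ a b, Measurable fun ω => Γhat ω a b) (_ : ∀ ω, (Γhat ω).IsDiag)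
        (δ : ℝ)
        (_ : 1 - c₃ / (2 * p) ≤
          P.real {ω | Pecok.variationSeminorm (Γhat ω - Pecok.covMatrix P₀ E) ≤ δ})
        (_ : Real.log p ≤ c₁ * n)
        (_ : ((c₂ * (Pecok.entrySupNorm (Pecok.covMatrix P₀ E) *
                (√(Real.log p / (Pecok.minGroupSize g * n))
                  + √(p / (n * (Pecok.minGroupSize g : ℝ) ^ 2))
                  + Real.log p / n
                  + p / (n * Pecok.minGroupSize g))
              + δ / Pecok.minGroupSize g) : ℝ) : EReal)
            ≤ Pecok.separation (Pecok.covMatrix P₀ Z)),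
        1 - c₃ / p < P.real {ω |
          Pecok.sdpArgmax K (Pecok.sampleCov (fun i => Xobs i ω) - Γhat ω)
            = {Pecok.partnershipMatrix g}} := by
  -- The failure probability is at most 13/p from the estimator (26/(2p)) plus 12/p from the noise;
  -- 26 > 25 makes the conclusion strict.
  refine ⟨1 / 40000, 40000, 26, by norm_num, by norm_num, by norm_num, ?_⟩
  intro n p K g Ω₀ _ P₀ _ X Z E hlat hX hm1 hpos Ω _ P _ Xobs hind hY Γhat _ hΓdiag δ hΓ hlog hsep
  have hp1 := one_lt_of_one_lt_minGroupSize hm1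
  have hp : (0 : ℝ) < p := by exact_mod_cast zero_lt_one.trans hp1
  have hlogp : 0 < Real.log p := Real.log_pos (by exact_mod_cast hp1)
  -- If n = 0, the assumption on log p gives log p ≤ 0, impossible as p > 1.
  have hn : 0 < n := by
    rcases Nat.eq_zero_or_pos n with rfl | h
    · norm_num at hlog; linarith
    · exact h
  have hn' : (0 : ℝ) < n := by exact_mod_cast hn
  have hm : (1 : ℝ) ≤ minGroupSize g := by exact_mod_cast hm1.le
  have hm0 : (0 : ℝ) < minGroupSize g := by linarith
  have hmin : ∀ k, (minGroupSize g : ℝ) ≤ (group g k).card := fun k => by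
    exact_mod_cast minGroupSize_le g k
  set m : ℝ := (minGroupSize g : ℝ)
  set Γ := covMatrix P₀ E with hΓdef
  set C := covMatrix P₀ Z
  have hC : C.IsSymm := covMatrix_isSymm P₀ Z
  have hΓd : Γ.IsDiag := hlat.isDiag_covMatrix_E
  have hcov : covMatrix P₀ X = C.submatrix g g + Γ := hlat.covMatrix_X
  set γ := entrySupNorm Γ
  have hγle : ∀ c, Γ c c ≤ γ := fun c => (le_abs_self _).trans (abs_apply_le_entrySupNorm Γ c c)
  have hγ : 0 ≤ γ := (abs_nonneg _).trans (abs_apply_le_entrySupNorm Γ ⟨0, by omega⟩ ⟨0, by omega⟩)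
  set Δ : Fin p → Fin p → ℝ := fun a b => C (g a) (g a) + C (g b) (g b) - 2 * C (g a) (g b) with hΔ
  have hΔpos : ∀ a b, g a ≠ g b → 0 < Δ a b := fun a b h => pos_of_pos_separation hC hpos h
  have hΔnn : ∀ a b, 0 ≤ Δ a b := fun a b => by
    by_cases h : g a = g b
    · simp only [hΔ, h]; linarith
    · exact (hΔpos a b h).le
  obtain ⟨bad, hbad, hgood⟩ := exists_measure_bad_le (g := g) (by omega) hn hX hlat.mean_X hind hY hγ
    (A := fun a b => Δ a b + 2 * γ / m) (fun a b => add_nonneg (hΔnn a b) (by positivity))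
    (fun a b => by
      rw [hcov, bilin, map_add, LinearMap.add_apply, LinearMap.add_apply, bilin_submatrix_avg_sub hC]
      refine add_le_add le_rfl ((bilin_self_le_of_isDiag hΓd hγle _).trans ?_)
      have h := avg_sub_dot_self_le (g := g) hm0 hmin a b
      have h2 : (avg g a - avg g b) ⬝ᵥ (avg g a - avg g b) ≤ 2 / m :=
        h.trans (by split_ifs; exacts [by positivity, le_rfl])
      calc _ ≤ γ * (2 / m) := mul_le_mul_of_nonneg_left h2 hγ
        _ = _ := by ring)
    (fun x hx => by
      rw [hcov, bilin, map_add, LinearMap.add_apply, LinearMap.add_apply,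
        bilin_submatrix_eq_zero C x hx, zero_add]
      exact bilin_self_le_of_isDiag hΓd hγle x)
  set good := {ω | sdpArgmax K (sampleCov (fun i => Xobs i ω) - Γhat ω) = {partnershipMatrix g}}
  -- On this event the rest is deterministic. Monotonicity and subadditivity need no measurability
  -- of the recovery event.
  have hsub : {ω | variationSeminorm (Γhat ω - Γ) ≤ δ} ⊆ good ∪ bad := by
    intro ω hω
    by_cases hωb : ω ∈ bad
    · exact Or.inr hωb
    refine Or.inl ?_
    obtain ⟨h1, h2, h3⟩ := hgood ω hωb
    obtain ⟨c, hc⟩ := exists_shift_of_variationSeminorm_le hω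
    -- The sign of δ is not assumed; it follows from the event being realized at ω.
    have hδ : 0 ≤ δ := (hc ⟨0, by omega⟩).1.trans (hc ⟨0, by omega⟩).2
    change sdpArgmax K _ = _
    rw [← sdpArgmax_add_smul_one _ c]
    have e : sampleCov (fun i => Xobs i ω) - Γhat ω + c • (1 : Matrix (Fin p) (Fin p) ℝ)
        = (sampleCov (fun i => Xobs i ω) - covMatrix P₀ X) + C.submatrix g g
          + (c • (1 : Matrix (Fin p) (Fin p) ℝ) - (Γhat ω - Γ)) := by
      rw [hcov]; abel
    have hDdiag : (c • (1 : Matrix (Fin p) (Fin p) ℝ) - (Γhat ω - Γ)).IsDiag :=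
      (Matrix.isDiag_one.smul c).sub ((hΓdiag ω).sub hΓd)
    have hDapp : ∀ a, (c • (1 : Matrix (Fin p) (Fin p) ℝ) - (Γhat ω - Γ)) a a
        = c - (Γhat ω - Γ) a a := fun a => by simp
    rw [e]
    refine sdpArgmax_eq_of_small_noise hC ((sampleCov_isSymm _).sub (covMatrix_isSymm _ _)) hDdiag
      hm0 hmin hδ (κ := 48 * γ * devRate n (8 * p))
      (mul_nonneg (by positivity) (devRate_nonneg (by positivity)))
      (fun a => by rw [hDapp]; exact (hc a).1) (fun a => by rw [hDapp]; exact (hc a).2) h3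
      fun a b hab => ?_
    have hs := le_of_le_separation hC hsep hab
    have har := separation_arith hγ hδ (hΔpos a b hab) hm hn' hp.le hlogp.le hlog
      (EReal.coe_le_coe_iff.1 hs)
    have h1' := h1 a b
    have h2' := h2 a b
    unfold devRate at h1' h2' ⊢
    simp only [hΔ] at har h1' h2'
    linarith
  have hle : P.real {ω | variationSeminorm (Γhat ω - Γ) ≤ δ} ≤ P.real good + P.real bad :=
    (measureReal_mono hsub).trans (measureReal_union_le _ _)
  have e1 : (26 : ℝ) / (2 * p) = 13 * (1 / p) := by field_simp; norm_num
  have e2 : (26 : ℝ) / p = 26 * (1 / p) := by ring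
  have e3 : (12 : ℝ) / p = 12 * (1 / p) := by ring
  have : (0 : ℝ) < 1 / p := by positivity
  rw [e1] at hΓ
  rw [e3] at hbad
  rw [e2]
  linarith
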